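/- There is an elliptic curve over $\mathbb{Q}$ with torsion group $\mathbb{Z}/2\mathbb{Z}\times\mathbb{Z}/2\mathbb{Z}$ whose rank is equal to $7$. Explicitly, for $t\in\mathbb{Q}$ put $D(t)=16t^4+64t^3+76t^2+24t-1$, $q(t)=2t^2+4t+1$ and $$b(t)=\frac{16t(t+1)(t+2)q(t)}{D(t)},\qquad d(t)=\frac{256t^8+2048t^7+6272t^6+8960t^5+5424t^4+192t^3-888t^2-112t+33}{16D(t)q(t)(t+1)},$$ $$e(t)=\frac{\begin{array}{l}4096t^{12}+49152t^{11}+262144t^{10}+819200t^9+1665024t^8+2310144t^7+2233728t^6\\{}+1507584t^5+697856t^4+211968t^3+38624t^2+3520t+105\end{array}}{16D(t)q(t)(t+1)}.$$ Then $b(2)=\frac{2176}{373}$, $d(2)=\frac{122265}{101456}$, $e(2)=\frac{192386145}{101456}$, so the member $t=2$ of the family $y^2=(b(t)x+1)(d(t)x+1)(e(t)x+1)$ is $$y^2=\Bigl(\tfrac{2176}{373}x+1\Bigr)\Bigl(\tfrac{192386145}{101456}x+1\Bigr)\Bigl(\tfrac{122265}{101456}x+1\Bigr).$$ With $N=373\cdot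 2176\cdot 192386145\cdot 122265$, the scaling $(x,y)\mapsto(Nx,\;373\cdot 101456\cdot N\,y)$ takes it to the Weierstrass curve $$\begin{aligned}E:\ y^2={}&x^3+19125010376436745905\,x^2+52038165131253677052054066913723699200\,x\\&+521987941186440643611574160434960523120404754595840000.\end{aligned}$$ The curve $E$ is an elliptic curve over $\mathbb{Q}$, its torsion group $E(\mathbb{Q})_{\mathrm{tors}}$ is isomorphic to $\mathbb{Z}/2\mathbb{Z}\times\mathbb{Z}/2\mathbb{Z}$, and its rank is exactly $7$, that is, $E(\mathbb{Q})\simeq E(\mathbb{Q})_{\mathrm{tors}}\times\mathbb{Z}^7$. Moreover the following seven points lie on $E$ and are independent in $E(\mathbb{Q})$ (no non-trivial integer combination of them is zero): $$P_1=(727040606274688800,\ 6989234854370183719797420000),$$ $$P_2=\Bigl(\tfrac{106210585076366036700000}{12769},\ \tfrac{69679298576214445317616490513378400}{1442897}\Bigr),$$ $$P_3=\Bigl(\tfrac{335675366319765814629760}{71289},\ \tfrac{529539341511970538352844395949129600}{19034163}\Bigr),$$ $$P_4=\Bigl(\tfrac{8891873190221412964144}{81},\ \tfrac{910251624041798036784012061900208}{729}\Bigr),$$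 $$P_5=\Bigl(\tfrac{101700294221755145291440}{841},\ \tfrac{34956857441184030025736520646806800}{24389}\Bigr),$$ $$P_6=\Bigl(\tfrac{73133606420424854742955}{114921},\ \tfrac{251397104609526457099162042379450150}{38958219}\Bigr),$$ $$P_7=(-11146430015095060400,\ 20291973801839968429609236400).$$ -/

import Mathlib

/-- First coefficient `b(t)` of the family `y² = (b(t)x + 1)(d(t)x + 1)(e(t)x + 1)`. -/
def famB (t : ℚ) : ℚ :=
  16 * t * (t + 1) * (t + 2) * (2 * t ^ 2 + 4 * t + 1) /
    (16 * t ^ 4 + 64 * t ^ 3 + 76 * t ^ 2 + 24 * t - 1)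

/-- Second coefficient `d(t)` of the family. -/
def famD (t : ℚ) : ℚ :=
  (256 * t ^ 8 + 2048 * t ^ 7 + 6272 * t ^ 6 + 8960 * t ^ 5 + 5424 * t ^ 4 + 192 * t ^ 3
      - 888 * t ^ 2 - 112 * t + 33) /
    (16 * (16 * t ^ 4 + 64 * t ^ 3 + 76 * t ^ 2 + 24 * t - 1) *
      (2 * t ^ 2 + 4 * t + 1) * (t + 1))

/-- Third coefficient `e(t)` of the family. -/
def famE (t : ℚ) : ℚ :=
  (4096 * t ^ 12 + 49152 * t ^ 11 + 262144 * t ^ 10 + 819200 * t ^ 9 + 1665024 * t ^ 8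
      + 2310144 * t ^ 7 + 2233728 * t ^ 6 + 1507584 * t ^ 5 + 697856 * t ^ 4
      + 211968 * t ^ 3 + 38624 * t ^ 2 + 3520 * t + 105) /
    (16 * (16 * t ^ 4 + 64 * t ^ 3 + 76 * t ^ 2 + 24 * t - 1) *
      (2 * t ^ 2 + 4 * t + 1) * (t + 1))

/-- The curve `y² = x³ + a₂x² + a₄x + a₆` over `ℚ` with the displayed integer coefficients. -/
def curveE : WeierstrassCurve ℚ where
  a₁ := 0
  a₂ := 19125010376436745905
  a₃ := 0
  a₄ := 52038165131253677052054066913723699200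
  a₆ := 521987941186440643611574160434960523120404754595840000

/-- The abelian group `E(ℚ)` of rational points, the point at infinity being `0`. -/
abbrev RatPoints (E : WeierstrassCurve ℚ) : Type := E.toAffine.Point

/-- `E(ℚ)` has rank `r`: there is an isomorphism `E(ℚ) ≃ E(ℚ)_tors × ℤ^r`. -/
def HasRank (E : WeierstrassCurve ℚ) (r : ℕ) : Prop :=
  Nonempty (RatPoints E ≃+ AddCommGroup.torsion (RatPoints E) × (Fin r → ℤ))

/-- The `x`-coordinates of the seven points. -/
def ptX : Fin 7 → ℚ :=
  ![727040606274688800,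
    106210585076366036700000 / 12769,
    335675366319765814629760 / 71289,
    8891873190221412964144 / 81,
    101700294221755145291440 / 841,
    73133606420424854742955 / 114921,
    -11146430015095060400]

/-- The `y`-coordinates of the seven points. -/
def ptY : Fin 7 → ℚ :=
  ![6989234854370183719797420000,
    69679298576214445317616490513378400 / 1442897,
    529539341511970538352844395949129600 / 19034163,
    910251624041798036784012061900208 / 729,
    34956857441184030025736520646806800 / 24389,
    251397104609526457099162042379450150 / 38958219,
    20291973801839968429609236400]

/-!
The theorem is proved by a complete 2-descent. Factoring the cubic, the curve is
`y² = (x - e₀)(x - e₁)(x - e₂)` with integers `eᵢ`, and the maps `P ↦ x(P) - eᵢ`, suitably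
corrected at the 2-torsion, are homomorphisms to `ℚˣ` modulo squares
(`splitCurve.isSquare_delta_add`) whose common kernel is `2E(ℚ)`
(`splitCurve.exists_add_self_eq`). Their values are supported at `-1` and the 19 primes
dividing a difference of two roots, so a point yields a vector of 40 bits (`descentClass`), the
third component being the product of the first two.

At an odd prime `p` modulo which exactly two of the roots coincide, the reduction is multiplicative,
and a point satisfies two linear conditions: its component at the isolated root `eᵢ` has even
valuation (`valParity_sub_eq_zero`), and the quadratic character of that component is determined by
the valuation of another one (`sum_legendreBit_mul_badClass`). The first condition also holds at
two. The conditions at two and at fifteen odd primes already cut out a space of dimension nine,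
spanned by the classes of the seven points and of two points of order two. This is linear algebra
over `ℤ/2`, certified by an explicit expression of the identity matrix
(`one_eq_genMatrix_mul_dualMatrix_add`). Hence `E(ℚ)/2E(ℚ)` has the known points as a basis.

Finiteness of this quotient and the approximate parallelogram law for the naive height give finite
generation (`fg_of_finiteIndex`). The parallelogram law follows from the formulas for `x(P + Q)` and
`x(P - Q)` (`addSubMap_sym2x`) and the height estimates for the quadratic map which they define.

The torsion is bounded at the prime three, where the reduction is additive. A nonzero point of odd
order is twice another one, so its differences `x - eᵢ` are squares; since `v₃(e₀ - e₁) = 1`, it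
reduces to a nonsingular point. On such points multiplication by three multiplies `|x|₃` by at least
nine (`nine_mul_xNorm_le`), which contradicts periodicity when the order is prime to three; points
of order three are excluded since the third division polynomial has no projective root modulo 47.
There are no points of order four, because the points of order two have nonzero classes. So the
torsion is the full 2-torsion, and the rank is `9 - 2 = 7` (`nonempty_addEquiv_torsion_prod`). The
seven points are independent since they are so modulo `E(ℚ)_tors + 2E(ℚ)`
(`linearIndependent_of_map_eq_single`).
-/

open WeierstrassCurve

/-! ### The 2-descent map of a curve with full 2-torsion -/

/-- The Weierstrass curve `y² = (x - e₀)(x - e₁)(x - e₂)`. -/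
def splitCurve {F : Type*} [Field F] (e : Fin 3 → F) : WeierstrassCurve F where
  a₁ := 0
  a₂ := -(e 0 + e 1 + e 2)
  a₃ := 0
  a₄ := e 0 * e 1 + e 0 * e 2 + e 1 * e 2
  a₆ := -(e 0 * e 1 * e 2)

namespace splitCurve

variable {F : Type*} [Field F] {e : Fin 3 → F}

lemma cubic_eq (i : Fin 3) (x : F) :
    x ^ 3 + -(e 0 + e 1 + e 2) * x ^ 2 + (e 0 * e 1 + e 0 * e 2 + e 1 * e 2) * x
      + -(e 0 * e 1 * e 2) = (x - e i) * (x - e (i + 1)) * (x - e (i + 2)) := by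
  fin_cases i <;> simp <;> ring

lemma equation_iff (i : Fin 3) {x y : F} :
    (splitCurve e).toAffine.Equation x y ↔
      y ^ 2 = (x - e i) * (x - e (i + 1)) * (x - e (i + 2)) := by
  rw [Affine.equation_iff, ← cubic_eq i x]
  simp [splitCurve]

lemma nonsingular_of_equation [NeZero (2 : F)] (he : Function.Injective e) {x y : F}
    (h : (splitCurve e).toAffine.Equation x y) : (splitCurve e).toAffine.Nonsingular x y := by
  have h2 : (2 : F) ≠ 0 := NeZero.ne _
  rw [Affine.nonsingular_iff']
  refine ⟨h, ?_⟩
  by_contra! hc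
  simp only [splitCurve] at hc
  obtain ⟨h1, h3⟩ := hc
  have hy : y = 0 := by
    have : 2 * y = 0 := by linear_combination h3
    simpa [h2] using this
  have h01 : e 0 - e 1 ≠ 0 := sub_ne_zero.2 (he.ne (by decide))
  have h02 : e 0 - e 2 ≠ 0 := sub_ne_zero.2 (he.ne (by decide))
  have h12 : e 1 - e 2 ≠ 0 := sub_ne_zero.2 (he.ne (by decide))
  have h4 := (equation_iff 0).1 h
  simp only [hy, zero_add] at h4
  have h5 : (x - e 0) * (x - e 1) * (x - e 2) = 0 := by
    rw [← h4]; ring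
  have h6 : (x - e 0) * (x - e 1) + (x - e 0) * (x - e 2) + (x - e 1) * (x - e 2) = 0 := by
    rw [hy] at h1
    linear_combination -h1
  rcases mul_eq_zero.1 h5 with h5 | h5
  · rcases mul_eq_zero.1 h5 with h5 | h5
    · obtain rfl : x = e 0 := sub_eq_zero.1 h5
      simp_all
    · obtain rfl : x = e 1 := sub_eq_zero.1 h5
      have : e 1 - e 0 ≠ 0 := by rwa [← neg_sub, neg_ne_zero]
      simp_all
  · obtain rfl : x = e 2 := sub_eq_zero.1 h5
    have : e 2 - e 0 ≠ 0 := by rwa [← neg_sub, neg_ne_zero]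
    have : e 2 - e 1 ≠ 0 := by rwa [← neg_sub, neg_ne_zero]
    simp_all

variable [DecidableEq F]

/-- The `i`-th component of the 2-descent map, as an element of `F`: it sends `(x, y)` to `x - eᵢ`,
except that at `x = eᵢ`, where this vanishes, it takes the product of the differences of `eᵢ` with
the other two roots. The product of the three components then remains a square. The point at
infinity goes to `1`. -/
def delta (e : Fin 3 → F) (i : Fin 3) : (splitCurve e).toAffine.Point → F
  | .zero => 1
  | .some x _ _ => if x = e i then (e i - e (i + 1)) * (e i - e (i + 2)) else x - e i

@[simp] lemma delta_zero (i : Fin 3) : delta e i 0 = 1 := rfl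

lemma delta_some (i : Fin 3) {x y : F} (h : (splitCurve e).toAffine.Nonsingular x y) :
    delta e i (.some x y h) =
      if x = e i then (e i - e (i + 1)) * (e i - e (i + 2)) else x - e i := rfl

@[simp] lemma delta_neg (i : Fin 3) (P : (splitCurve e).toAffine.Point) :
    delta e i (-P) = delta e i P := by
  cases P <;> rfl

lemma delta_ne_zero (he : Function.Injective e) (i : Fin 3) (P : (splitCurve e).toAffine.Point) :
    delta e i P ≠ 0 := by
  rcases P with _ | ⟨x, y, h⟩
  · exact one_ne_zero
  · rw [delta_some]
    split_ifs with hx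
    · exact mul_ne_zero (sub_ne_zero.2 (he.ne (by fin_cases i <;> decide)))
        (sub_ne_zero.2 (he.ne (by fin_cases i <;> decide)))
    · exact sub_ne_zero.2 hx

/-- Three collinear points, evaluated at an arbitrary abscissa `t`. -/
lemma line_eval (i : Fin 3) {x₁ y₁ x₂ y₂ : F} (h₁ : (splitCurve e).toAffine.Nonsingular x₁ y₁)
    (h₂ : (splitCurve e).toAffine.Nonsingular x₂ y₂)
    (hxy : ¬(x₁ = x₂ ∧ y₁ = (splitCurve e).toAffine.negY x₂ y₂)) (t : F) :
    let l := (splitCurve e).toAffine.slope x₁ x₂ y₁ y₂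
    (l * (t - x₁) + y₁) ^ 2 - (t - e i) * (t - e (i + 1)) * (t - e (i + 2)) =
      -((t - x₁) * (t - x₂) * (t - (splitCurve e).toAffine.addX x₁ x₂ l)) := by
  dsimp only
  have := congrArg (Polynomial.eval t) (Affine.addPolynomial_slope h₁.1 h₂.1 hxy)
  rw [← cubic_eq]
  generalize (splitCurve e).toAffine.slope x₁ x₂ y₁ y₂ = l at this ⊢
  generalize (splitCurve e).toAffine.addX x₁ x₂ l = x₃ at this ⊢
  simp only [Affine.addPolynomial, Affine.linePolynomial, Affine.polynomial] at this
  simp [splitCurve, Polynomial.eval_mul] at this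
  linear_combination this

/-- The case of multiplicativity in which the first point is the 2-torsion point `(eᵢ, 0)`. -/
lemma isSquare_delta_add_of_eq_root (he : Function.Injective e) (i : Fin 3) {y₁ x₂ y₂ : F}
    (h₁ : (splitCurve e).toAffine.Nonsingular (e i) y₁)
    (h₂ : (splitCurve e).toAffine.Nonsingular x₂ y₂) :
    IsSquare (delta e i (.some _ _ h₁ + .some _ _ h₂) *
      (delta e i (.some _ _ h₁) * delta e i (.some _ _ h₂))) := by
  have hy₁ : y₁ = 0 := by
    have := (equation_iff i).1 h₁.1
    simpa using this
  by_cases hx : e i = x₂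
  · subst hx
    have hy₂ : y₂ = 0 := by
      have := (equation_iff i).1 h₂.1
      simpa using this
    subst hy₁ hy₂
    rw [Affine.Point.add_of_Y_eq rfl (by simp [Affine.negY, splitCurve])]
    exact ⟨_, by rw [delta_zero, one_mul]⟩
  · have hxy : ¬(e i = x₂ ∧ y₁ = (splitCurve e).toAffine.negY x₂ y₂) := fun h ↦ hx h.1
    have hl := line_eval i h₁ h₂ hxy
    rw [Affine.Point.add_some hxy]
    set l := (splitCurve e).toAffine.slope (e i) x₂ y₁ y₂
    set x₃ := (splitCurve e).toAffine.addX (e i) x₂ l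
    subst hy₁
    -- Dividing the collinearity identity by `t - eᵢ`.
    have key (t : F) (ht : t ≠ e i) :
        l ^ 2 * (t - e i) - (t - e (i + 1)) * (t - e (i + 2)) = -((t - x₂) * (t - x₃)) := by
      have h := hl t
      refine mul_left_cancel₀ (sub_ne_zero.2 ht) ?_
      simp only at h
      linear_combination h
    have ha : e (i + 1) ≠ e i := he.ne (by fin_cases i <;> decide)
    have hb : e (i + 2) ≠ e i := he.ne (by fin_cases i <;> decide)
    have hab : e (i + 1) - e (i + 2) ≠ 0 := sub_ne_zero.2 (he.ne (by fin_cases i <;> decide))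
    -- The quadratic identity holds at two points and has equal leading terms, hence at `eᵢ`.
    have hx₃ : x₃ = l ^ 2 + (e (i + 1) + e (i + 2)) - x₂ := by
      refine mul_left_cancel₀ hab ?_
      have h1 := key _ ha
      have h2 := key _ hb
      linear_combination h2 - h1
    have h0 : (e i - e (i + 1)) * (e i - e (i + 2)) = (x₂ - e i) * (x₃ - e i) := by
      have h1 := key _ ha
      rw [hx₃] at h1 ⊢
      linear_combination -h1
    have hx₃e : x₃ ≠ e i := by
      intro h
      rw [h, sub_self, mul_zero] at h0
      exact mul_ne_zero (sub_ne_zero.2 ha.symm) (sub_ne_zero.2 hb.symm) h0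
    rw [delta_some, delta_some, delta_some, if_neg hx₃e, if_pos rfl, if_neg (Ne.symm hx), h0]
    exact ⟨(x₂ - e i) * (x₃ - e i), by ring⟩

/-- Multiplicativity of the descent map modulo squares. -/
theorem isSquare_delta_add (he : Function.Injective e) (i : Fin 3)
    (P Q : (splitCurve e).toAffine.Point) :
    IsSquare (delta e i (P + Q) * (delta e i P * delta e i Q)) := by
  rcases P with _ | ⟨x₁, y₁, h₁⟩
  · rw [← Affine.Point.zero_def, zero_add, delta_zero, one_mul]
    exact ⟨_, rfl⟩
  rcases Q with _ | ⟨x₂, y₂, h₂⟩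
  · rw [← Affine.Point.zero_def, add_zero, delta_zero, mul_one]
    exact ⟨_, rfl⟩
  by_cases hx₁ : x₁ = e i
  · subst hx₁; exact isSquare_delta_add_of_eq_root he i h₁ h₂
  by_cases hx₂ : x₂ = e i
  · subst hx₂
    rw [add_comm (Affine.Point.some _ _ h₁), mul_comm (delta e i (Affine.Point.some _ _ h₁))]
    exact isSquare_delta_add_of_eq_root he i h₂ h₁
  by_cases hxy : x₁ = x₂ ∧ y₁ = (splitCurve e).toAffine.negY x₂ y₂
  · rw [Affine.Point.add_of_Y_eq hxy.1 hxy.2, delta_zero, one_mul, delta_some, delta_some, hxy.1]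
    exact ⟨_, rfl⟩
  have hl := line_eval i h₁ h₂ hxy (e i)
  by_cases hx₃ : (splitCurve e).toAffine.addX x₁ x₂
      ((splitCurve e).toAffine.slope x₁ x₂ y₁ y₂) = e i
  · -- If the sum is `T = (eᵢ, 0)`, apply the previous case to `P = T - Q`.
    obtain ⟨P, hP⟩ : ∃ P, P = Affine.Point.some _ _ h₁ := ⟨_, rfl⟩
    obtain ⟨y₃, h₃, hadd⟩ : ∃ y₃, ∃ h₃ : (splitCurve e).toAffine.Nonsingular (e i) y₃,
        Affine.Point.some _ _ h₁ + Affine.Point.some _ _ h₂ = Affine.Point.some _ _ h₃ := by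
      rw [Affine.Point.add_some hxy]
      have := Affine.nonsingular_add h₁ h₂ hxy
      rw [hx₃] at this
      exact ⟨_, this, by simp only [hx₃]⟩
    have h := isSquare_delta_add_of_eq_root he i h₃ ((Affine.nonsingular_neg ..).2 h₂)
    rw [← Affine.Point.neg_some h₂, ← hadd, add_neg_cancel_right, delta_neg] at h
    obtain ⟨r, hr⟩ := h
    exact ⟨r, by rw [← hr]; ring⟩
  · rw [Affine.Point.add_some hxy, delta_some, delta_some, delta_some, if_neg hx₁, if_neg hx₂,
      if_neg hx₃]
    simp only [sub_self, zero_mul, sub_zero] at hl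
    exact ⟨(splitCurve e).toAffine.slope x₁ x₂ y₁ y₂ * (e i - x₁) + y₁,
      by linear_combination -hl⟩

/-- A point whose three differences `x - eᵢ` are squares is divisible by two. -/
theorem exists_add_self_eq [NeZero (2 : F)] (he : Function.Injective e) {x y : F}
    (h : (splitCurve e).toAffine.Nonsingular x y) (hsq : ∀ i, IsSquare (x - e i)) :
    ∃ Q : (splitCurve e).toAffine.Point, Q + Q = .some x y h := by
  have h2 : (2 : F) ≠ 0 := NeZero.ne _
  have h01 : e 0 - e 1 ≠ 0 := sub_ne_zero.2 (he.ne (by decide))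
  have h02 : e 0 - e 2 ≠ 0 := sub_ne_zero.2 (he.ne (by decide))
  have h12 : e 1 - e 2 ≠ 0 := sub_ne_zero.2 (he.ne (by decide))
  obtain ⟨r, hr⟩ := hsq 0
  obtain ⟨s, hs⟩ := hsq 1
  obtain ⟨t', ht'⟩ := hsq 2
  have heq : y ^ 2 = (x - e 0) * (x - e 1) * (x - e 2) := (equation_iff 0).1 h.1
  -- Choose the sign of the third root so that the product of the roots is `y`.
  obtain ⟨t, ht, hy⟩ : ∃ t, x - e 2 = t * t ∧ y = r * s * t := by
    have : y ^ 2 = (r * s * t') ^ 2 := by rw [heq, hr, hs, ht']; ring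
    rcases sq_eq_sq_iff_eq_or_eq_neg.1 this with h | h
    · exact ⟨t', ht', h⟩
    · exact ⟨-t', by rw [ht']; ring, by rw [h]; ring⟩
  have hrs : r + s ≠ 0 := fun h0 ↦ h01 (by linear_combination hs - hr - (r - s) * h0)
  have hrt : r + t ≠ 0 := fun h0 ↦ h02 (by linear_combination ht - hr - (r - t) * h0)
  have hst : s + t ≠ 0 := fun h0 ↦ h12 (by linear_combination ht - hs - (s - t) * h0)
  have e0 : e 0 = x - r * r := by linear_combination -hr
  have e1 : e 1 = x - s * s := by linear_combination -hs
  have e2 : e 2 = x - t * t := by linear_combination -ht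
  set u := x + (r * s + r * t + s * t) with hu
  set v := (r + s) * (r + t) * (s + t) with hv
  have hv0 : v ≠ 0 := mul_ne_zero (mul_ne_zero hrs hrt) hst
  have hE : (splitCurve e).toAffine.Equation u v := by
    rw [equation_iff 0]
    simp only [zero_add, e0, e1, e2, hu, hv]
    ring
  have hN := nonsingular_of_equation he hE
  have hne : v ≠ (splitCurve e).toAffine.negY u v := by
    intro h0
    have : 2 * v = 0 := by
      simp only [Affine.negY, splitCurve] at h0
      linear_combination h0
    simp [h2, hv0] at this
  have hslope : (splitCurve e).toAffine.slope u u v v = r + s + t := by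
    rw [Affine.slope_of_Y_ne rfl hne]
    simp only [Affine.negY, splitCurve]
    have : v - (-v - 0 * u - 0) ≠ 0 := by
      intro h0
      exact mul_ne_zero h2 hv0 (by linear_combination h0)
    rw [div_eq_iff this, e0, e1, e2, hu, hv]
    ring
  have hX : (splitCurve e).toAffine.addX u u (r + s + t) = x := by
    simp only [Affine.addX, splitCurve, e0, e1, e2, hu]
    ring
  have hY : (splitCurve e).toAffine.addY u u v (r + s + t) = y := by
    rw [Affine.addY, Affine.negAddY, hX, hy]
    simp only [Affine.negY, splitCurve, hu, hv]
    ring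
  refine ⟨.some u v hN, ?_⟩
  rw [Affine.Point.add_self_of_Y_ne hne]
  simp only [hslope, hX, hY]

end splitCurve

/-! ### The map `(P, Q) ↦ (P + Q, P - Q)` on abscissae -/

namespace WeierstrassCurve.Affine.Point

variable {F : Type*} [Field F] [DecidableEq F] {W : WeierstrassCurve F}

/-- The generic case: points with distinct abscissae. -/
lemma addSubMap_sym2x_of_X_ne {x₁ y₁ x₂ y₂ : F} (h₁ : W.toAffine.Nonsingular x₁ y₁)
    (h₂ : W.toAffine.Nonsingular x₂ y₂) (hx : x₁ ≠ x₂) :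
    (fun i ↦ (addSubMap W i).eval (sym2x (.some _ _ h₁ : W.toAffine.Point) (.some _ _ h₂))) =
      (x₁ - x₂) ^ 2 • sym2x (.some _ _ h₁ + .some _ _ h₂) (.some _ _ h₁ - .some _ _ h₂) := by
  have hd : x₁ - x₂ ≠ 0 := sub_ne_zero.2 hx
  have e₁ : y₁ ^ 2 + W.a₁ * x₁ * y₁ + W.a₃ * y₁ = x₁ ^ 3 + W.a₂ * x₁ ^ 2 + W.a₄ * x₁ + W.a₆ :=
    (Affine.equation_iff ..).1 h₁.1
  have e₂ : y₂ ^ 2 + W.a₁ * x₂ * y₂ + W.a₃ * y₂ = x₂ ^ 3 + W.a₂ * x₂ ^ 2 + W.a₄ * x₂ + W.a₆ :=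
    (Affine.equation_iff ..).1 h₂.1
  rw [sub_eq_add_neg (Affine.Point.some _ _ h₁), neg_some, add_of_X_ne hx, add_of_X_ne hx,
    sym2x_some_some, sym2x_some_some, Affine.slope_of_X_ne hx, Affine.slope_of_X_ne hx]
  simp only [Affine.addX, Affine.negY]
  funext i
  fin_cases i
  · simp [addSubMap, WeierstrassCurve.b₂, WeierstrassCurve.b₄, WeierstrassCurve.b₆,
      WeierstrassCurve.b₈]
    field_simp
    have e₁' : y₁ ^ 2 = x₁ ^ 3 + W.a₂ * x₁ ^ 2 + W.a₄ * x₁ + W.a₆ - W.a₁ * x₁ * y₁ - W.a₃ * y₁ := by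
      linear_combination e₁
    have e₂' : W.a₆ =
        y₂ ^ 2 + W.a₁ * x₂ * y₂ + W.a₃ * y₂ - (x₂ ^ 3 + W.a₂ * x₂ ^ 2 + W.a₄ * x₂) := by
      linear_combination -e₂
    grind
  · simp [addSubMap, WeierstrassCurve.b₂, WeierstrassCurve.b₄, WeierstrassCurve.b₆]
    field_simp
    linear_combination (-2 : F) * e₁ - 2 * e₂
  · simp [addSubMap]
    ring

/-- The doubling case. -/
lemma addSubMap_sym2x_self [W.IsElliptic] (P : W.toAffine.Point) :
    ∃ c : F, c ≠ 0 ∧ (fun i ↦ (addSubMap W i).eval (sym2x P P)) = c • sym2x (P + P) 0 := by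
  rcases P with _ | ⟨x, y, h⟩
  · refine ⟨1, one_ne_zero, ?_⟩
    rw [← zero_def, add_zero, sym2x_zero_zero]
    funext i
    fin_cases i <;> simp [addSubMap]
  have e : y ^ 2 + W.a₁ * x * y + W.a₃ * y = x ^ 3 + W.a₂ * x ^ 2 + W.a₄ * x + W.a₆ :=
    (Affine.equation_iff ..).1 h.1
  have hψ : 4 * x ^ 3 + W.b₂ * x ^ 2 + 2 * W.b₄ * x + W.b₆ = (2 * y + W.a₁ * x + W.a₃) ^ 2 := by
    simp only [WeierstrassCurve.b₂, WeierstrassCurve.b₄, WeierstrassCurve.b₆]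
    linear_combination (-4 : F) * e
  by_cases hy : y = W.toAffine.negY x y
  · have hy' : 2 * y + W.a₁ * x + W.a₃ = 0 := by
      rw [Affine.negY] at hy
      linear_combination hy
    have hne := addSubMap_ne_zero W (sym2x_ne_zero (.some x y h : W.toAffine.Point) (.some x y h))
    rw [add_self_of_Y_eq hy, sym2x_zero_zero]
    set v := fun i ↦ (addSubMap W i).eval (sym2x (.some x y h : W.toAffine.Point) (.some x y h))
      with hv
    have hv1 : v 1 = 0 := by
      simp [hv, addSubMap]
      rw [hy'] at hψ
      linear_combination hψ
    have hv2 : v 2 = 0 := by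
      simp [hv, addSubMap]
      ring
    refine ⟨v 0, fun h0 ↦ hne ?_, ?_⟩
    · funext i
      fin_cases i
      exacts [h0, hv1, hv2]
    · funext i
      fin_cases i
      · simp
      · simpa using hv1
      · simpa using hv2
  · have hy' : 2 * y + W.a₁ * x + W.a₃ ≠ 0 := by
      rw [Affine.negY] at hy
      exact fun h0 ↦ hy (by linear_combination h0)
    have hy'' : y - (-y - W.a₁ * x - W.a₃) ≠ 0 := fun h0 ↦ hy' (by linear_combination h0)
    refine ⟨(2 * y + W.a₁ * x + W.a₃) ^ 2, pow_ne_zero _ hy', ?_⟩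
    rw [add_self_of_Y_ne hy, sym2x_some_some, sym2x_some_zero, Affine.slope_of_Y_ne rfl hy]
    funext i
    fin_cases i
    · obtain ⟨d, hd⟩ : ∃ d, d = 2 * y + W.a₁ * x + W.a₃ := ⟨_, rfl⟩
      have h2 : y - (-y - W.a₁ * x - W.a₃) = d := by rw [hd]; ring
      have e6 : W.a₆ = y ^ 2 + W.a₁ * x * y + W.a₃ * y - (x ^ 3 + W.a₂ * x ^ 2 + W.a₄ * x) := by
        linear_combination -e
      rw [← hd] at hy' ⊢
      simp [addSubMap, Affine.addX, Affine.negY, h2]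
      field_simp
      simp only [hd, WeierstrassCurve.b₄, WeierstrassCurve.b₆, WeierstrassCurve.b₈, e6]
      ring
    · simp [addSubMap]
      linear_combination hψ
    · simp [addSubMap]
      ring

/-- The polynomial map `addSubMap` describes `(P, Q) ↦ (P + Q, P - Q)` on symmetric pairs of
`x`-coordinates. -/
theorem addSubMap_sym2x [W.IsElliptic] (P Q : W.toAffine.Point) :
    ∃ c : F, c ≠ 0 ∧
      (fun i ↦ (addSubMap W i).eval (sym2x P Q)) = c • sym2x (P + Q) (P - Q) := by
  by_cases h1 : P = Q
  · subst h1
    simpa using addSubMap_sym2x_self P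
  by_cases h2 : P = -Q
  · obtain rfl : Q = -P := by rw [h2, neg_neg]
    obtain ⟨c, hc, h⟩ := addSubMap_sym2x_self P
    refine ⟨c, hc, ?_⟩
    rw [sym2x_neg_right, h, add_neg_cancel, sub_neg_eq_add, sym2x_comm]
  rcases P with _ | ⟨x₁, y₁, h₁⟩
  · refine ⟨1, one_ne_zero, ?_⟩
    rw [← zero_def, zero_add, zero_sub, sym2x_neg_right, one_smul]
    rcases Q with _ | ⟨x, y, h⟩
    · exact absurd rfl h1
    · rw [sym2x_zero_some, sym2x_some_some]
      funext i
      fin_cases i <;> simp [addSubMap] <;> ring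
  rcases Q with _ | ⟨x₂, y₂, h₂⟩
  · refine ⟨1, one_ne_zero, ?_⟩
    rw [← zero_def, add_zero, sub_zero, one_smul, sym2x_some_zero, sym2x_some_some]
    funext i
    fin_cases i <;> simp [addSubMap] <;> ring
  have hx : x₁ ≠ x₂ := fun hx ↦ (X_eq_iff.1 hx).elim h1 h2
  exact ⟨_, pow_ne_zero 2 (sub_ne_zero.2 hx), addSubMap_sym2x_of_X_ne h₁ h₂ hx⟩

end WeierstrassCurve.Affine.Point

/-! ### Finite generation from the finiteness of `E(K)/2E(K)` -/

namespace WeierstrassCurve.Affine.Point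

variable {K : Type*} [Field K] [DecidableEq K] [Height.AdmissibleAbsValues K]
  {W : WeierstrassCurve K}

/-- The naive logarithmic height of a point: the height of its `x`-coordinate. -/
noncomputable def naiveHeight (P : W.toAffine.Point) : ℝ := Height.logHeight P.xRep

/-- The approximate parallelogram law for the naive height. -/
theorem exists_abs_naiveHeight_add_sub_le [W.IsElliptic] :
    ∃ C : ℝ, ∀ P Q : W.toAffine.Point,
      |naiveHeight (P + Q) + naiveHeight (P - Q) - 2 * (naiveHeight P + naiveHeight Q)| ≤ C := by
  obtain ⟨C₁, hC₁⟩ := abs_logHeight_addSubMap_sub_two_mul_logHeight_le W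
  obtain ⟨C₂, hC₂⟩ := Height.abs_logHeight_sym2_sub_le K
  have hsym (P Q : W.toAffine.Point) :
      |Height.logHeight (sym2x P Q) - (naiveHeight P + naiveHeight Q)| ≤ C₂ := by
    have hvec (R : W.toAffine.Point) : ![R.xRep 0, R.xRep 1] = R.xRep := by
      funext i; fin_cases i <;> rfl
    have h := hC₂ (a := P.xRep 0) (b := P.xRep 1) (c := Q.xRep 0) (d := Q.xRep 1)
      (by rw [hvec]; exact xRep_ne_zero P) (by rw [hvec]; exact xRep_ne_zero Q)
    rw [hvec, hvec] at h
    exact h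
  refine ⟨C₁ + 3 * C₂, fun P Q ↦ ?_⟩
  obtain ⟨c, hc, h⟩ := addSubMap_sym2x P Q
  have h1 := hC₁ (sym2x P Q)
  rw [h, Height.logHeight_smul_eq_logHeight _ hc] at h1
  have h2 := hsym P Q
  have h3 := hsym (P + Q) (P - Q)
  rw [abs_le] at *
  constructor <;> linarith [h1.1, h1.2, h2.1, h2.2, h3.1, h3.2]

instance [Northcott (Height.mulHeight₁ (K := K))] :
    Northcott (naiveHeight : W.toAffine.Point → ℝ) where
  finite_le B := by
    have hfin : {x : K | Height.logHeight₁ x ≤ B}.Finite := Northcott.finite_le B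
    -- A point is determined up to sign by its `x`-coordinate.
    have hfib (v : Fin 2 → K) : {P : W.toAffine.Point | P.xRep = v}.Finite := by
      rcases Set.eq_empty_or_nonempty {P : W.toAffine.Point | P.xRep = v} with h | ⟨Q, hQ⟩
      · rw [h]; exact Set.finite_empty
      · refine (Set.toFinite {Q, -Q}).subset fun P hP ↦ ?_
        exact eq_or_eq_neg_of_xRep_eq_xRep (hP.trans hQ.symm)
    refine (((hfin.image fun x ↦ ![x, 1]).insert ![1, 0]).biUnion fun v _ ↦ hfib v).subset
      fun P hP ↦ ?_
    simp only [Set.mem_iUnion, Set.mem_ofPred_eq, exists_prop, exists_eq_right']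
    rcases P with _ | ⟨x, y, h⟩
    · exact Or.inl xRep_zero
    · refine Or.inr ⟨x, ?_, (xRep_some h).symm⟩
      have : naiveHeight (.some x y h : W.toAffine.Point) ≤ B := hP
      rwa [naiveHeight, xRep_some, ← Height.logHeight₁_eq_logHeight] at this

/-- The descent step of the Mordell–Weil theorem. -/
theorem fg_of_finiteIndex [Northcott (Height.mulHeight₁ (K := K))] [W.IsElliptic]
    (h : (nsmulAddMonoidHom (α := W.toAffine.Point) 2).range.FiniteIndex) :
    AddGroup.FG W.toAffine.Point := by
  obtain ⟨C, hC⟩ := exists_abs_naiveHeight_add_sub_le (W := W)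
  exact AddCommGroup.fg_of_descent' (h := naiveHeight) h (fun P ↦ Height.logHeight_nonneg _) hC

end WeierstrassCurve.Affine.Point

/-! ### Square classes of rational numbers -/

/-- The sign of a rational number as a class in `ℤ/2`. -/
def signClass (q : ℚ) : ZMod 2 := if q < 0 then 1 else 0

/-- The parity of the `p`-adic valuation of a rational number. -/
def valParity (p : ℕ) (q : ℚ) : ZMod 2 := (padicValRat p q : ZMod 2)

lemma signClass_mul {a b : ℚ} (ha : a ≠ 0) (hb : b ≠ 0) :
    signClass (a * b) = signClass a + signClass b := by
  unfold signClass
  rcases ha.lt_or_gt with ha | ha <;> rcases hb.lt_or_gt with hb | hb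
  · rw [if_neg (mul_pos_of_neg_of_neg ha hb).not_gt, if_pos ha, if_pos hb]; decide
  · rw [if_pos (mul_neg_of_neg_of_pos ha hb), if_pos ha, if_neg hb.not_gt]; decide
  · rw [if_pos (mul_neg_of_pos_of_neg ha hb), if_neg ha.not_gt, if_pos hb]; decide
  · rw [if_neg (mul_pos ha hb).not_gt, if_neg ha.not_gt, if_neg hb.not_gt]; decide

lemma valParity_mul (p : ℕ) [Fact p.Prime] {a b : ℚ} (ha : a ≠ 0) (hb : b ≠ 0) :
    valParity p (a * b) = valParity p a + valParity p b := by
  simp [valParity, padicValRat.mul ha hb]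

lemma valParity_intCast_of_not_dvd {p : ℕ} {z : ℤ} (h : ¬ (p : ℤ) ∣ z) : valParity p z = 0 := by
  simp [valParity, padicValInt.eq_zero_of_not_dvd h]

lemma valParity_intCast_eq_one {p : ℕ} [Fact p.Prime] {z : ℤ} (h : (p : ℤ) ∣ z)
    (h2 : ¬ (p : ℤ) ^ 2 ∣ z) : valParity p z = 1 := by
  obtain ⟨w, rfl⟩ := h
  have hw : ¬ (p : ℤ) ∣ w := fun hw ↦ h2 (by rw [sq]; exact mul_dvd_mul_left _ hw)
  have hp : (p : ℚ) ≠ 0 := by exact_mod_cast (Fact.out : p.Prime).ne_zero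
  have hw0 : (w : ℚ) ≠ 0 := by
    rintro h0
    exact hw (by rw [show w = 0 by exact_mod_cast h0]; exact dvd_zero _)
  push_cast
  rw [valParity_mul p hp hw0, valParity_intCast_of_not_dvd hw, add_zero, valParity,
    padicValRat.self (Fact.out : p.Prime).one_lt]
  rfl

lemma isSquare_of_even_padicValNat {n : ℕ} (hn : n ≠ 0)
    (h : ∀ p : ℕ, p.Prime → Even (padicValNat p n)) : IsSquare n := by
  obtain ⟨a, b, hab, ha⟩ := Nat.sq_mul_squarefree n
  have ha0 : a ≠ 0 := ha.ne_zero
  have hb0 : b ≠ 0 := by rintro rfl; simp at hab; exact hn hab.symm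
  suffices a = 1 by rw [← hab, this, mul_one]; exact ⟨b, sq b⟩
  by_contra ha1
  obtain ⟨p, hp, hpa⟩ := Nat.exists_prime_and_dvd ha1
  have := Fact.mk hp
  have h1 := h p hp
  rw [← hab, padicValNat.mul (pow_ne_zero 2 hb0) ha0, padicValNat.pow,
    Nat.even_add] at h1
  have h2 : padicValNat p a = 1 := by
    have h3 : padicValNat p a ≠ 0 := (dvd_iff_padicValNat_ne_zero ha0).1 hpa
    have h4 : ¬ 2 ≤ padicValNat p a := by
      rw [← padicValNat_dvd_iff_le ha0]
      intro h5
      exact hp.one_lt.ne' (Nat.isUnit_iff.1 (ha p (by rwa [← sq])))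
    omega
  rw [h2] at h1
  simp at h1

/-- A positive rational number all of whose valuations are even is a square. -/
lemma isSquare_of_valParity_eq_zero {q : ℚ} (hq : 0 < q)
    (h : ∀ p : ℕ, p.Prime → valParity p q = 0) : IsSquare q := by
  have hnum : 0 < q.num := Rat.num_pos.2 hq
  have hn0 : q.num.natAbs * q.den ≠ 0 := mul_ne_zero (by omega) q.den_nz
  have heq : ((q.num.natAbs * q.den : ℕ) : ℚ) = q * (q.den * q.den) := by
    push_cast
    rw [Nat.cast_natAbs, abs_of_pos hnum]
    have := Rat.mul_den_eq_num q
    linear_combination -(q.den : ℚ) * this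
  have hd : (q.den : ℚ) ≠ 0 := by exact_mod_cast q.den_nz
  have hsq : IsSquare (q.num.natAbs * q.den) := by
    refine isSquare_of_even_padicValNat hn0 fun p hp ↦ ?_
    have := Fact.mk hp
    have h1 : valParity p ((q.num.natAbs * q.den : ℕ) : ℚ) = 0 := by
      rw [heq, valParity_mul p hq.ne' (mul_ne_zero hd hd), valParity_mul p hd hd, h p hp, zero_add,
        CharTwo.add_self_eq_zero]
    rw [valParity, padicValRat.of_nat] at h1
    exact (ZMod.natCast_eq_zero_iff_even).1 (by exact_mod_cast h1)
  obtain ⟨r, hr⟩ := hsq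
  refine ⟨r / q.den, ?_⟩
  rw [hr] at heq
  push_cast at heq
  field_simp
  linear_combination -heq

/-- Generators of the group of square classes in which the 2-descent takes place: `-1` and the
primes which divide a difference of two roots of the cubic. -/
def badGen : Fin 20 → ℤ :=
  ![-1, 2, 3, 5, 7, 11, 13, 17, 19, 23, 29, 37, 41, 67, 79, 373, 397, 1187, 1193, 1259]

/-- The square class of a rational number, read off from its sign and its valuations at the bad
primes. -/
def badClass (q : ℚ) (k : Fin 20) : ZMod 2 :=
  if k = 0 then signClass q else valParity (badGen k).natAbs q

lemma prime_badGen {k : Fin 20} (hk : k ≠ 0) : (badGen k).natAbs.Prime := by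
  fin_cases k
  · exact absurd rfl hk
  all_goals norm_num [badGen]

lemma badGen_ne_zero (k : Fin 20) : badGen k ≠ 0 := by
  revert k; decide

lemma badClass_mul {a b : ℚ} (ha : a ≠ 0) (hb : b ≠ 0) :
    badClass (a * b) = badClass a + badClass b := by
  funext k
  rw [Pi.add_apply]
  unfold badClass
  split_ifs with hk
  · exact signClass_mul ha hb
  · have := Fact.mk (prime_badGen hk)
    exact valParity_mul _ ha hb

lemma badClass_one : badClass 1 = 0 := by
  have := badClass_mul one_ne_zero one_ne_zero
  simpa using this

lemma badClass_mul_self {a : ℚ} (ha : a ≠ 0) : badClass (a * a) = 0 := by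
  rw [badClass_mul ha ha]
  funext k
  exact CharTwo.add_self_eq_zero _

lemma badClass_eq_zero_of_isSquare {a : ℚ} (ha : a ≠ 0) (h : IsSquare a) : badClass a = 0 := by
  obtain ⟨r, rfl⟩ := h
  exact badClass_mul_self (by rintro rfl; simp at ha)

lemma valParity_eq_zero_of_isSquare (p : ℕ) [Fact p.Prime] {a : ℚ} (ha : a ≠ 0) (h : IsSquare a) :
    valParity p a = 0 := by
  obtain ⟨r, rfl⟩ := h
  have hr : r ≠ 0 := by rintro rfl; simp at ha
  rw [valParity_mul p hr hr, CharTwo.add_self_eq_zero]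

lemma badClass_badGen (j : Fin 20) : badClass (badGen j) = Pi.single j 1 := by
  funext k
  have hinj : ∀ j k : Fin 20, j ≠ k → (badGen j).natAbs ≠ (badGen k).natAbs := by decide
  have hpos : ∀ j : Fin 20, j ≠ 0 → 0 < badGen j := by decide
  unfold badClass
  split_ifs with hk
  · subst hk
    by_cases hj : j = 0
    · subst hj
      simp [signClass, badGen]
    · rw [Pi.single_eq_of_ne (Ne.symm hj), signClass, if_neg]
      exact not_lt.2 (by exact_mod_cast (hpos j hj).le)
  · have := Fact.mk (prime_badGen hk)
    by_cases hjk : j = k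
    · subst hjk
      rw [Pi.single_eq_same]
      have h1 : ((badGen j).natAbs : ℤ) = badGen j := Int.natAbs_of_nonneg (hpos j hk).le
      have h2 : ((badGen j : ℤ) : ℚ) = ((badGen j).natAbs : ℚ) := by
        rw [← Int.cast_natCast, h1]
      rw [h2, valParity, padicValRat.self (prime_badGen hk).one_lt]
      rfl
    · rw [Pi.single_eq_of_ne (Ne.symm hjk)]
      refine valParity_intCast_of_not_dvd fun hd ↦ ?_
      rw [Int.natCast_dvd] at hd
      by_cases hj : j = 0
      · subst hj
        exact (prime_badGen hk).one_lt.ne' (Nat.dvd_one.1 hd)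
      · exact hinj j k hjk
          ((Nat.prime_dvd_prime_iff_eq (prime_badGen hk) (prime_badGen hj)).1 hd).symm

/-- The squarefree integer with a prescribed class. -/
def classRep (b : Fin 20 → ZMod 2) : ℤ := ∏ k, badGen k ^ (b k).val

lemma classRep_ne_zero (b : Fin 20 → ZMod 2) : classRep b ≠ 0 :=
  Finset.prod_ne_zero_iff.2 fun k _ ↦ pow_ne_zero _ (badGen_ne_zero k)

lemma badClass_classRep (b : Fin 20 → ZMod 2) : badClass (classRep b) = b := by
  have key (s : Finset (Fin 20)) :
      badClass ((∏ k ∈ s, badGen k ^ (b k).val : ℤ) : ℚ) = ∑ k ∈ s, Pi.single k (b k) := by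
    induction s using Finset.induction_on with
    | empty => simpa using badClass_one
    | insert a s ha ih =>
      rw [Finset.prod_insert ha, Finset.sum_insert ha, Int.cast_mul, badClass_mul, ih]
      · congr 1
        have : ∀ z : ZMod 2, z = 0 ∨ z = 1 := by decide
        rcases this (b a) with h | h
        · rw [h]; simpa using badClass_one
        · rw [h, ZMod.val_one, pow_one, badClass_badGen]
      · exact_mod_cast pow_ne_zero _ (badGen_ne_zero a)
      · exact_mod_cast Finset.prod_ne_zero_iff.2 fun k _ ↦ pow_ne_zero _ (badGen_ne_zero k)
  rw [classRep, key, Finset.univ_sum_single]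

/-- A number with even valuations away from the bad primes and trivial class is a square. -/
lemma isSquare_of_badClass_eq_zero {q : ℚ} (hq : q ≠ 0)
    (h : ∀ p : ℕ, p.Prime → (∀ k, p ≠ (badGen k).natAbs) → valParity p q = 0)
    (h0 : badClass q = 0) : IsSquare q := by
  have hs := congrFun h0 0
  rw [badClass, if_pos rfl, signClass] at hs
  have hpos : 0 < q := by
    refine lt_of_le_of_ne (not_lt.1 fun hneg ↦ ?_) hq.symm
    rw [if_pos hneg] at hs
    exact one_ne_zero hs
  refine isSquare_of_valParity_eq_zero hpos fun p hp ↦ ?_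
  by_cases hk : ∃ k, p = (badGen k).natAbs
  · obtain ⟨k, rfl⟩ := hk
    have := congrFun h0 k
    rwa [badClass, if_neg] at this
    rintro rfl
    exact Nat.not_prime_one hp
  · exact h p hp (not_exists.1 hk)

lemma isSquare_classRep_mul {q : ℚ} (hq : q ≠ 0)
    (h : ∀ p : ℕ, p.Prime → (∀ k, p ≠ (badGen k).natAbs) → valParity p q = 0) :
    IsSquare ((classRep (badClass q) : ℚ) * q) := by
  have hr : (classRep (badClass q) : ℚ) ≠ 0 := by exact_mod_cast classRep_ne_zero _
  refine isSquare_of_badClass_eq_zero (mul_ne_zero hr hq) (fun p hp hk ↦ ?_) ?_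
  · have := Fact.mk hp
    rw [valParity_mul p hr hq, h p hp hk, add_zero]
    refine valParity_intCast_of_not_dvd fun hd ↦ ?_
    obtain ⟨k, -, hk'⟩ := (Nat.prime_iff_prime_int.1 hp).exists_mem_finset_dvd hd
    have h1 := (Nat.prime_iff_prime_int.1 hp).dvd_of_dvd_pow hk'
    rw [Int.natCast_dvd] at h1
    by_cases hk0 : k = 0
    · subst hk0
      exact hp.one_lt.ne' (Nat.dvd_one.1 h1)
    · exact hk k ((Nat.prime_dvd_prime_iff_eq hp (prime_badGen hk0)).1 h1)
  · rw [badClass_mul hr hq, badClass_classRep]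
    funext k
    exact CharTwo.add_self_eq_zero _

/-! ### Local conditions on the descent map -/

/-- Rational points on `y² = (x - e₀)(x - e₁)(x - e₂)` with integral `eᵢ` are of the form
`(X / Z², Y / Z³)` with `X` and `Z` coprime. -/
lemma exists_integral_coordinates (e : Fin 3 → ℤ) {x y : ℚ}
    (h : y ^ 2 = (x - e 0) * (x - e 1) * (x - e 2)) :
    ∃ X Y Z : ℤ, Z ≠ 0 ∧ IsCoprime X Z ∧ x * Z ^ 2 = X ∧
      (X - e 0 * Z ^ 2) * (X - e 1 * Z ^ 2) * (X - e 2 * Z ^ 2) = Y ^ 2 := by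
  obtain ⟨n, d, hd, hcop, hx⟩ : ∃ n d : ℤ, 0 < d ∧ IsCoprime n d ∧ x * d = n :=
    ⟨x.num, x.den, by exact_mod_cast x.den_pos, by
      rw [Int.isCoprime_iff_nat_coprime]; exact x.reduced, Rat.mul_den_eq_num x⟩
  set N := (n - e 0 * d) * (n - e 1 * d) * (n - e 2 * d) with hN
  have hdN : IsCoprime d N := by
    have (i : Fin 3) : IsCoprime d (n - e i * d) := by
      have := hcop.symm.add_mul_left_right (-e i)
      rwa [show n + d * -e i = n - e i * d by ring] at this
    exact ((this 0).mul_right (this 1)).mul_right (this 2)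
  -- `d² y` has the integral square `d N`.
  have hsq : ((d * N : ℤ) : ℚ) = (d ^ 2 * y) ^ 2 := by
    rw [mul_pow, h, hN]
    push_cast
    rw [← hx]
    ring
  have : IsSquare (d * N) := by
    rw [← Rat.isSquare_intCast_iff, hsq]
    exact ⟨_, sq _⟩
  obtain ⟨w, hw⟩ := this
  obtain ⟨Z, hZ⟩ := Int.sq_of_isCoprime hdN (hw.trans (sq w).symm)
  replace hZ : d = Z ^ 2 := hZ.resolve_right fun h0 ↦ by nlinarith [sq_nonneg Z]
  have hZ0 : Z ≠ 0 := by rintro rfl; simp at hZ; omega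
  have hZw : Z ∣ w := by
    rw [← Int.pow_dvd_pow_iff two_ne_zero, sq w, ← hw, hZ]
    exact dvd_mul_right _ _
  obtain ⟨Y, rfl⟩ := hZw
  refine ⟨n, Y, Z, hZ0, ?_, by rw [← hx, hZ]; push_cast; ring, ?_⟩
  · rw [hZ] at hcop
    exact (IsCoprime.pow_right_iff two_pos).1 hcop
  · have : Z ^ 2 * N = Z ^ 2 * Y ^ 2 := by linear_combination hw - N * hZ
    rw [← hZ]
    exact mul_left_cancel₀ (pow_ne_zero 2 hZ0) this

lemma valParity_eq_zero_of_mul_mul_eq_sq {p : ℕ} [Fact p.Prime] {A B C Y : ℤ} (hA : A ≠ 0)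
    (hB : B ≠ 0) (hC : C ≠ 0) (h : A * B * C = Y ^ 2) (hpB : (p : ℤ) ∣ A → ¬ (p : ℤ) ∣ B)
    (hpC : (p : ℤ) ∣ A → ¬ (p : ℤ) ∣ C) : valParity p A = 0 := by
  by_cases hpA : (p : ℤ) ∣ A
  · have hA' : (A : ℚ) ≠ 0 := by exact_mod_cast hA
    have hB' : (B : ℚ) ≠ 0 := by exact_mod_cast hB
    have hC' : (C : ℚ) ≠ 0 := by exact_mod_cast hC
    have h1 : valParity p ((A * B * C : ℤ) : ℚ) = 0 := by
      refine valParity_eq_zero_of_isSquare p ?_ ?_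
      · push_cast; exact mul_ne_zero (mul_ne_zero hA' hB') hC'
      · rw [h]; push_cast; exact ⟨_, sq _⟩
    push_cast at h1
    rwa [valParity_mul p (mul_ne_zero hA' hB') hC', valParity_mul p hA' hB',
      valParity_intCast_of_not_dvd (hpB hpA), valParity_intCast_of_not_dvd (hpC hpA), add_zero,
      add_zero] at h1
  · exact valParity_intCast_of_not_dvd hpA

/-- The differences `x - eⱼ` of a rational point outside the 2-torsion, in integral form: with the
denominator `Z²` cleared they become integers `D j`, and `Z` is prime to each of them. -/
lemma exists_integral_differences (e : Fin 3 → ℤ) {x y : ℚ}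
    (h : y ^ 2 = (x - e 0) * (x - e 1) * (x - e 2)) (hy : y ≠ 0) :
    ∃ (D : Fin 3 → ℤ) (Y Z : ℤ), Z ≠ 0 ∧ (∀ j, D j ≠ 0) ∧ (∀ j, x - e j ≠ 0) ∧
      (∀ j, (D j : ℚ) = (x - e j) * (Z * Z)) ∧ (∀ i, D i * D (i + 1) * D (i + 2) = Y ^ 2) ∧
      (∀ j k, D k - D j = (e j - e k) * Z ^ 2) ∧
      ∀ (p : ℕ) [Fact p.Prime] (j : Fin 3), (p : ℤ) ∣ D j → ¬ (p : ℤ) ∣ Z := by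
  obtain ⟨X, Y, Z, hZ, hcop, hX, hY⟩ := exists_integral_coordinates e h
  have hZ' : (Z : ℚ) ≠ 0 := by exact_mod_cast hZ
  have hf (j : Fin 3) : ((X - e j * Z ^ 2 : ℤ) : ℚ) = (x - e j) * (Z * Z) := by
    push_cast; rw [← hX]; ring
  have hx (j : Fin 3) : x - e j ≠ 0 := by
    intro h0
    refine hy (pow_eq_zero_iff (two_ne_zero) |>.1 ?_)
    rw [h]
    fin_cases j <;> simp only [Fin.zero_eta, Fin.mk_one, Fin.reduceFinMk] at h0 <;> rw [h0] <;> ring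
  have hne (j : Fin 3) : X - e j * Z ^ 2 ≠ 0 := by
    have : ((X - e j * Z ^ 2 : ℤ) : ℚ) ≠ 0 := by
      rw [hf]; exact mul_ne_zero (hx j) (mul_ne_zero hZ' hZ')
    exact_mod_cast this
  refine ⟨fun j ↦ X - e j * Z ^ 2, Y, Z, hZ, hne, hx, hf, fun i ↦ ?_, fun j k ↦ by ring,
    fun p _ j hj hz ↦ ?_⟩
  · rw [← hY]
    fin_cases i <;> simp <;> ring
  · have hp : Prime (p : ℤ) := Nat.prime_iff_prime_int.1 Fact.out
    have : (p : ℤ) ∣ X := by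
      have := dvd_add hj ((dvd_pow hz two_ne_zero).mul_left (e j))
      rwa [sub_add_cancel] at this
    exact hp.not_isUnit (hcop.isUnit_of_dvd' this hz)

lemma dvd_sub_of_dvd_differences {p : ℕ} [Fact p.Prime] {e D : Fin 3 → ℤ} {Z : ℤ}
    (hD : ∀ j k, D k - D j = (e j - e k) * Z ^ 2)
    (hZ : ∀ (p : ℕ) [Fact p.Prime] (j : Fin 3), (p : ℤ) ∣ D j → ¬ (p : ℤ) ∣ Z) {j k : Fin 3}
    (hj : (p : ℤ) ∣ D j) (hk : (p : ℤ) ∣ D k) : (p : ℤ) ∣ e j - e k := by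
  have hp : Prime (p : ℤ) := Nat.prime_iff_prime_int.1 Fact.out
  have h3 := dvd_sub hk hj
  rw [hD] at h3
  exact (hp.dvd_or_dvd h3).resolve_right fun h4 ↦ hZ p j hj (hp.dvd_of_dvd_pow h4)

/-- A prime which separates `eᵢ` from the two other roots divides `x - eᵢ` to an even power. -/
lemma valParity_sub_eq_zero {p : ℕ} [Fact p.Prime] (e : Fin 3 → ℤ) (i : Fin 3)
    {x y : ℚ} (h : y ^ 2 = (x - e 0) * (x - e 1) * (x - e 2)) (hy : y ≠ 0)
    (h1 : ¬ (p : ℤ) ∣ e (i + 1) - e i) (h2 : ¬ (p : ℤ) ∣ e (i + 2) - e i) :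
    valParity p (x - e i) = 0 := by
  obtain ⟨D, Y, Z, hZ, hne, hx, hf, hABC, hdiff, hpZ⟩ := exists_integral_differences e h hy
  have hZ' : (Z : ℚ) ≠ 0 := by exact_mod_cast hZ
  have h3 := valParity_eq_zero_of_mul_mul_eq_sq (p := p) (hne _) (hne _) (hne _) (hABC i)
    (fun ha hb ↦ h1 (dvd_sub_of_dvd_differences hdiff hpZ hb ha))
    (fun ha hb ↦ h2 (dvd_sub_of_dvd_differences hdiff hpZ hb ha))
  rwa [hf, valParity_mul p (hx i) (mul_ne_zero hZ' hZ'), valParity_mul p hZ' hZ',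
    CharTwo.add_self_eq_zero, add_zero] at h3

/-- The Legendre symbol as an element of `ℤ/2`, in a form that evaluates by Euler's criterion: `0`
for the nonzero squares modulo `p`, and `1` for the nonsquares (and also for the multiples of
`p`). -/
def legendreBit (p : ℕ) (a : ℤ) : ZMod 2 :=
  if (a % p).toNat ^ (p / 2) % p = 1 then 0 else 1

section legendreBit

variable {p : ℕ} [Fact p.Prime]

lemma intCast_zmod_ne_zero {a : ℤ} (ha : ¬ (p : ℤ) ∣ a) : (a : ZMod p) ≠ 0 := by
  rwa [Ne, ZMod.intCast_zmod_eq_zero_iff_dvd]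

lemma legendreBit_eq_zero_iff {a : ℤ} (ha : ¬ (p : ℤ) ∣ a) :
    legendreBit p a = 0 ↔ IsSquare (a : ZMod p) := by
  have hp : p.Prime := Fact.out
  have h1 : (((a % p).toNat : ℕ) : ZMod p) = (a : ZMod p) := by
    have h2 : ((a % p).toNat : ℤ) = a % p :=
      Int.toNat_of_nonneg (Int.emod_nonneg _ (by exact_mod_cast hp.ne_zero))
    rw [← Int.cast_natCast, h2]
    simp
  rw [ZMod.euler_criterion p (intCast_zmod_ne_zero ha), ← h1, ← Nat.cast_pow,
    ← Nat.cast_one, ZMod.natCast_eq_natCast_iff', Nat.mod_eq_of_lt hp.one_lt, legendreBit]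
  split_ifs with h <;> simp [h]

lemma legendreBit_mul {a b : ℤ} (ha : ¬ (p : ℤ) ∣ a) (hb : ¬ (p : ℤ) ∣ b) :
    legendreBit p (a * b) = legendreBit p a + legendreBit p b := by
  have hp : Prime (p : ℤ) := Nat.prime_iff_prime_int.1 Fact.out
  have hab : ¬ (p : ℤ) ∣ a * b := hp.not_dvd_mul ha hb
  have key {c : ℤ} (hc : ¬ (p : ℤ) ∣ c) : legendreBit p c = 0 ↔ legendreSym p c = 1 := by
    rw [legendreBit_eq_zero_iff hc, legendreSym.eq_one_iff p (intCast_zmod_ne_zero hc)]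
  have key' {c : ℤ} (hc : ¬ (p : ℤ) ∣ c) : legendreBit p c = 1 ↔ legendreSym p c = -1 := by
    rw [legendreSym.eq_neg_one_iff_not_one p (intCast_zmod_ne_zero hc), ← key hc]
    generalize legendreBit p c = z
    revert z; decide
  have hz : ∀ z : ZMod 2, z = 0 ∨ z = 1 := by decide
  rcases hz (legendreBit p a) with h1 | h1 <;> rcases hz (legendreBit p b) with h2 | h2 <;>
    rw [h1, h2] <;> simp only [key ha, key hb, key' ha, key' hb] at h1 h2
  · rw [add_zero, key hab, legendreSym.mul, h1, h2, one_mul]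
  · rw [zero_add, key' hab, legendreSym.mul, h1, h2, one_mul]
  · rw [add_zero, key' hab, legendreSym.mul, h1, h2, mul_one]
  · rw [CharTwo.add_self_eq_zero, key hab, legendreSym.mul, h1, h2]; norm_num

lemma legendreBit_one : legendreBit p 1 = 0 := by
  have hp : Prime (p : ℤ) := Nat.prime_iff_prime_int.1 Fact.out
  have := legendreBit_mul (p := p) (a := 1) (b := 1) (fun h ↦ hp.not_dvd_one h)
    (fun h ↦ hp.not_dvd_one h)
  simpa using this

lemma not_dvd_badGen_pow {b : Fin 20 → ZMod 2}
    (hb : ∀ k, (p : ℤ) ∣ badGen k → b k = 0) (k : Fin 20) :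
    ¬ (p : ℤ) ∣ badGen k ^ (b k).val := by
  have hp : Prime (p : ℤ) := Nat.prime_iff_prime_int.1 Fact.out
  intro h
  have h1 := hb k (hp.dvd_of_dvd_pow h)
  rw [h1] at h
  simp at h
  exact hp.not_dvd_one (by simpa using h)

lemma not_dvd_classRep {b : Fin 20 → ZMod 2} (hb : ∀ k, (p : ℤ) ∣ badGen k → b k = 0) :
    ¬ (p : ℤ) ∣ classRep b := by
  have hp : Prime (p : ℤ) := Nat.prime_iff_prime_int.1 Fact.out
  intro h
  obtain ⟨k, -, hk⟩ := hp.exists_mem_finset_dvd h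
  exact not_dvd_badGen_pow hb k hk

lemma legendreBit_classRep {b : Fin 20 → ZMod 2} (hb : ∀ k, (p : ℤ) ∣ badGen k → b k = 0) :
    legendreBit p (classRep b) = ∑ k, legendreBit p (badGen k) * b k := by
  have hp : Prime (p : ℤ) := Nat.prime_iff_prime_int.1 Fact.out
  have key (s : Finset (Fin 20)) : ¬ (p : ℤ) ∣ ∏ k ∈ s, badGen k ^ (b k).val ∧
      legendreBit p (∏ k ∈ s, badGen k ^ (b k).val) = ∑ k ∈ s, legendreBit p (badGen k) * b k := by
    induction s using Finset.induction_on with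
    | empty => exact ⟨by simpa using hp.not_dvd_one, by simpa using legendreBit_one⟩
    | insert a s ha ih =>
      rw [Finset.prod_insert ha, Finset.sum_insert ha]
      have hka := not_dvd_badGen_pow hb a
      refine ⟨hp.not_dvd_mul hka ih.1, ?_⟩
      rw [legendreBit_mul hka ih.1, ih.2]
      congr 1
      have : ∀ z : ZMod 2, z = 0 ∨ z = 1 := by decide
      rcases this (b a) with h | h
      · rw [h]; simpa using legendreBit_one
      · rw [h, ZMod.val_one, pow_one, mul_one]
  exact (key _).2

/-- Integers whose product is a square have the same Legendre symbol. -/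
lemma legendreBit_eq_of_isSquare_mul {a b : ℤ} (ha : ¬ (p : ℤ) ∣ a) (hb : ¬ (p : ℤ) ∣ b)
    (h : IsSquare ((a : ZMod p) * b)) : legendreBit p a = legendreBit p b := by
  have hp : Prime (p : ℤ) := Nat.prime_iff_prime_int.1 Fact.out
  have h1 : legendreBit p (a * b) = 0 := by
    rw [legendreBit_eq_zero_iff (hp.not_dvd_mul ha hb)]; exact_mod_cast h
  rw [legendreBit_mul ha hb] at h1
  exact CharTwo.add_eq_zero.1 h1

end legendreBit

/-- The local condition at a prime `p` of multiplicative reduction: `e (i + 1)` and `e (i + 2)`, but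
not `e i`, coincide modulo `p`. In the split case `legendreBit p (e (i + 1) - e i) = 0` the
`i`-th component is locally trivial; in the nonsplit case with `v_p (e (i + 1) - e (i + 2)) = 1` it
is a nonresidue exactly when the two other components have odd valuation. -/
theorem sum_legendreBit_mul_badClass {p : ℕ} [Fact p.Prime] (e : Fin 3 → ℤ) (i : Fin 3)
    {x y : ℚ} (h : y ^ 2 = (x - e 0) * (x - e 1) * (x - e 2)) (hy : y ≠ 0)
    (h1 : ¬ (p : ℤ) ∣ e (i + 1) - e i) (h2 : ¬ (p : ℤ) ∣ e (i + 2) - e i)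
    (h12 : (p : ℤ) ∣ e (i + 1) - e (i + 2))
    (hns : legendreBit p (e (i + 1) - e i) = 0 ∨ ¬ (p : ℤ) ^ 2 ∣ e (i + 1) - e (i + 2))
    (hgood : ∀ q : ℕ, q.Prime → (∀ k, q ≠ (badGen k).natAbs) → valParity q (x - e i) = 0) :
    ∑ k, legendreBit p (badGen k) * badClass (x - e i) k =
      legendreBit p (e (i + 1) - e i) * valParity p (x - e (i + 1)) := by
  have hp : Prime (p : ℤ) := Nat.prime_iff_prime_int.1 Fact.out
  obtain ⟨D, Y, Z, hZ, hne, hx, hf, hABC, hdiff, hpZ⟩ := exists_integral_differences e h hy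
  replace hABC := hABC i
  have hZ' : (Z : ℚ) ≠ 0 := by exact_mod_cast hZ
  have hBCd := hdiff (i + 1) (i + 2)
  have hBC : (p : ℤ) ∣ D (i + 2) - D (i + 1) := by
    rw [hBCd]
    exact h12.mul_right _
  have hvi := valParity_sub_eq_zero (p := p) e i h hy h1 h2
  have hval1 : valParity p (D (i + 1)) = valParity p (x - e (i + 1)) := by
    rw [hf, valParity_mul p (hx _) (mul_ne_zero hZ' hZ'), valParity_mul p hZ' hZ',
      CharTwo.add_self_eq_zero, add_zero]
  -- `d` is the squarefree integer representing the `i`-th component; it is prime to `p`.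
  have hb : ∀ k, (p : ℤ) ∣ badGen k → badClass (x - e i) k = 0 := by
    intro k hk
    rw [Int.natCast_dvd] at hk
    have hk0 : k ≠ 0 := by
      rintro rfl
      exact (Fact.out : p.Prime).one_lt.ne' (Nat.dvd_one.1 hk)
    rw [badClass, if_neg hk0, ← (Nat.prime_dvd_prime_iff_eq Fact.out (prime_badGen hk0)).1 hk]
    exact hvi
  rw [← legendreBit_classRep hb]
  have hpd := not_dvd_classRep hb
  obtain ⟨w, hw⟩ : IsSquare (classRep (badClass (x - e i)) * D i) := by
    rw [← Rat.isSquare_intCast_iff, Int.cast_mul, hf, ← mul_assoc]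
    exact (isSquare_classRep_mul (hx i) hgood).mul ⟨_, rfl⟩
  generalize classRep (badClass (x - e i)) = d at hw hpd
  have hA0 := hne i
  have hB0 := hne (i + 1)
  have hC0 := hne (i + 2)
  have hAB : (p : ℤ) ∣ D (i + 1) → ¬ (p : ℤ) ∣ D i :=
    fun hb ha ↦ h1 (dvd_sub_of_dvd_differences hdiff hpZ hb ha)
  have hAf : ((D i : ℤ) : ZMod p) =
      (D (i + 1) : ZMod p) + ((e (i + 1) - e i : ℤ) : ZMod p) * Z * Z := by
    have := congrArg (Int.cast : ℤ → ZMod p) (hdiff (i + 1) i)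
    push_cast at this ⊢
    linear_combination this
  have hpZB := hpZ p (i + 1)
  rw [← hval1]
  generalize D i = A at *
  generalize D (i + 1) = B at *
  generalize D (i + 2) = C at *
  by_cases hpB : (p : ℤ) ∣ B
  · have hpA := hAB hpB
    have hZp := hpZB hpB
    have hpC : (p : ℤ) ∣ C := by simpa using dvd_add hBC hpB
    rw [(ZMod.intCast_zmod_eq_zero_iff_dvd B p).2 hpB, zero_add] at hAf
    have hd : legendreBit p d = legendreBit p (e (i + 1) - e i) := by
      refine (legendreBit_eq_of_isSquare_mul hpd hpA ?_).trans
        (legendreBit_eq_of_isSquare_mul hpA h1 ?_)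
      · exact ⟨(w : ZMod p), by exact_mod_cast congrArg (Int.cast : ℤ → ZMod p) hw⟩
      · rw [hAf]
        exact ⟨((e (i + 1) - e i : ℤ) : ZMod p) * Z, by ring⟩
    rw [hd]
    rcases hns with h0 | hp2
    · rw [h0, zero_mul]
    · -- One of `B`, `C` has valuation exactly one, since their difference does.
      suffices valParity p B = 1 by rw [this, mul_one]
      by_cases hB2 : (p : ℤ) ^ 2 ∣ B
      · have hC2 : ¬ (p : ℤ) ^ 2 ∣ C := by
          intro hC2
          have h3 := dvd_sub hC2 hB2
          rw [hBCd] at h3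
          exact hp2 ((IsCoprime.pow ((Prime.coprime_iff_not_dvd hp).2 hZp)).dvd_of_dvd_mul_right h3)
        have hAq : (A : ℚ) ≠ 0 := by exact_mod_cast hA0
        have hBq : (B : ℚ) ≠ 0 := by exact_mod_cast hB0
        have hCq : (C : ℚ) ≠ 0 := by exact_mod_cast hC0
        have h4 : valParity p ((A * B * C : ℤ) : ℚ) = 0 := by
          refine valParity_eq_zero_of_isSquare p ?_ ?_
          · push_cast; exact mul_ne_zero (mul_ne_zero hAq hBq) hCq
          · rw [hABC]; push_cast; exact ⟨_, sq _⟩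
        push_cast at h4
        rw [valParity_mul p (mul_ne_zero hAq hBq) hCq, valParity_mul p hAq hBq,
          valParity_intCast_of_not_dvd hpA, valParity_intCast_eq_one hpC hC2, zero_add] at h4
        exact CharTwo.add_eq_zero.1 h4
      · exact valParity_intCast_eq_one hpB hB2
  · rw [valParity_intCast_of_not_dvd hpB, mul_zero, legendreBit_eq_zero_iff hpd]
    -- `d B C` is a square and `B ≡ C` modulo `p`.
    obtain ⟨v, hv⟩ : IsSquare (d * B * C) := by
      rw [← Rat.isSquare_intCast_iff]
      refine ⟨(w * Y : ℚ) / A, ?_⟩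
      have hAq : (A : ℚ) ≠ 0 := by exact_mod_cast hA0
      have hw' : (d * A : ℚ) = w * w := by exact_mod_cast hw
      have hY' : (A * B * C : ℚ) = Y ^ 2 := by exact_mod_cast hABC
      field_simp
      push_cast
      linear_combination (A * B * C : ℚ) * hw' + (w : ℚ) ^ 2 * hY'
    have hCB : (C : ZMod p) = B := by
      rw [← sub_eq_zero, ← Int.cast_sub, ZMod.intCast_zmod_eq_zero_iff_dvd]; exact hBC
    have hB := intCast_zmod_ne_zero hpB
    have hv' : (d * B * C : ZMod p) = v * v := by exact_mod_cast congrArg (Int.cast : ℤ → ZMod p) hv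
    refine ⟨v / B, ?_⟩
    rw [hCB] at hv'
    field_simp
    linear_combination hv'

/-! ### The curve and its descent classes -/

/-- The roots of the cubic defining `curveE`. -/
def rootE : Fin 3 → ℤ :=
  ![-3272605140431451825, -15842337133909493760, -10068102095800320]

lemma curveE_eq : curveE = splitCurve (fun i ↦ (rootE i : ℚ)) := by
  have h2 : rootE 2 = -10068102095800320 := rfl
  ext <;> norm_num [curveE, splitCurve, h2] <;> norm_num [rootE]

lemma rootE_injective : Function.Injective (fun i ↦ (rootE i : ℚ)) :=
  Int.cast_injective.comp (by decide)

/-- The group of rational points, written in terms of the roots. -/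
abbrev PointE : Type := (splitCurve (fun i ↦ (rootE i : ℚ))).toAffine.Point

/-- The pair of square classes of the first two components of the 2-descent map. -/
def descentClass : PointE →+ (Fin 2 × Fin 20 → ZMod 2) where
  toFun P ck := badClass (splitCurve.delta (fun i ↦ (rootE i : ℚ)) ck.1.castSucc P) ck.2
  map_zero' := by
    funext ck
    rw [splitCurve.delta_zero, badClass_one]; rfl
  map_add' P Q := by
    funext ck
    have h := splitCurve.isSquare_delta_add rootE_injective ck.1.castSucc P Q
    have h1 := splitCurve.delta_ne_zero rootE_injective ck.1.castSucc P
    have h2 := splitCurve.delta_ne_zero rootE_injective ck.1.castSucc Q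
    have h3 := splitCurve.delta_ne_zero rootE_injective ck.1.castSucc (P + Q)
    have h4 := congrFun (badClass_eq_zero_of_isSquare (mul_ne_zero h3 (mul_ne_zero h1 h2)) h) ck.2
    rw [badClass_mul h3 (mul_ne_zero h1 h2), badClass_mul h1 h2] at h4
    exact CharTwo.add_eq_zero.1 h4

/-! ### The linear algebra over `ℤ/2` -/

/-- A matrix over `ℤ/2` with columns indexed by the 40 descent coordinates, each row being given by
the binary digits of a natural number. -/
def bitMatrix {m : ℕ} (rows : Fin m → ℕ) : Matrix (Fin m) (Fin 2 × Fin 20) (ZMod 2) :=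
  fun i ck ↦ if (rows i).testBit (20 * ck.1 + ck.2) then 1 else 0

/-- The descent classes of the seven points and of two 2-torsion points. -/
def genMatrix : Matrix (Fin 9) (Fin 2 × Fin 20) (ZMod 2) :=
  bitMatrix ![846253789188, 301350464276, 297428786440, 297560906848, 889193214280, 284684397864,
    292737319489, 598641196885, 890820408861]

/-- Linear forms dual to the rows of `genMatrix`. -/
def dualMatrix : Matrix (Fin 9) (Fin 2 × Fin 20) (ZMod 2) :=
  bitMatrix ![584115552256, 335007449088, 275012124672, 829062905856, 881542037504, 292057776128,
    598611066880, 826244333568, 22011707392]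

/-- The positions in `badGen` of the primes modulo which exactly two of the roots coincide. -/
def multPos : Fin 16 → Fin 20 := ![1, 4, 5, 6, 7, 8, 9, 10, 11, 12, 13, 14, 16, 17, 18, 19]

/-- For each of the primes given by `multPos`, the root which is isolated modulo that prime. -/
def multIdx : Fin 16 → Fin 3 := ![0, 2, 1, 1, 0, 1, 2, 2, 1, 2, 2, 0, 1, 1, 0, 2]

/-- The coefficient of the `c`-th component of the descent map in the `i`-th one. -/
def compCoeff (i : Fin 3) (c : Fin 2) : ZMod 2 := if i = 2 ∨ i = c.castSucc then 1 else 0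

/-- The linear forms `v_p(δᵢ)`, for the primes `p` of `multPos` with isolated root `eᵢ`. -/
def valForm : Matrix (Fin 16) (Fin 2 × Fin 20) (ZMod 2) :=
  fun l ck ↦ if ck.2 = multPos l then compCoeff (multIdx l) ck.1 else 0

/-- The linear forms `χ_p(δᵢ) + χ_p(e_{i+1} - eᵢ) v_p(δ_{i+1})`, for the odd primes `p` of
`multPos` with isolated root `eᵢ`. At `p = 2` there is no such condition, and the row is zero. -/
def legForm : Matrix (Fin 16) (Fin 2 × Fin 20) (ZMod 2) :=
  fun l ck ↦ if l = 0 then 0 else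
    legendreBit (badGen (multPos l)).natAbs (badGen ck.2) * compCoeff (multIdx l) ck.1 +
      if ck.2 = multPos l then
        legendreBit (badGen (multPos l)).natAbs (rootE (multIdx l + 1) - rootE (multIdx l)) *
          compCoeff (multIdx l + 1) ck.1
      else 0

lemma valForm_eq : valForm = bitMatrix ![2, 16777232, 33554432, 67108864, 128, 268435456, 536871424,
    1073742848, 2147483648, 4294971392, 8589942784, 16384, 68719476736, 137438953472, 262144,
    549756338176] := by
  decide +kernel

lemma legForm_eq : legForm = bitMatrix ![0, 898149192141, 194870509568, 633836929088, 483004,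
    342598091008, 1025349970361, 712334006694, 19270731776, 650138707444, 751753162879, 17180449941,
    863517081600, 980757250048, 1016732, 933454779747] := by
  decide +kernel

lemma dualMatrix_mul_genMatrix : dualMatrix * genMatrix.transpose = 1 := by
  decide +kernel

/-- The local conditions cut out exactly the span of the known points: the identity is the sum of
the projector onto that span and of combinations of the local conditions. The coefficients of these
combinations come from solving a linear system over `ℤ/2`. -/
lemma one_eq_genMatrix_mul_dualMatrix_add :
    (1 : Matrix (Fin 2 × Fin 20) (Fin 2 × Fin 20) (ZMod 2)) =
      genMatrix.transpose * dualMatrix +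
      (bitMatrix ![22216790, 18055489, 48234573, 96567352, 23103640, 269519200, 17892209, 22250577,
        2147484005, 135204, 4333856, 17908056, 68726884609, 137444327429, 19171633,
        19401012]).transpose * valForm +
      (bitMatrix ![0, 7440741, 32735576, 7571744, 23070741, 17924213, 17924445, 7571821, 4360485,
        19040572, 7407937, 4227328, 17989968, 11698220, 7407972,
        22118520]).transpose * legForm := by
  rw [valForm_eq, legForm_eq]
  decide +kernel

lemma eq_of_localForms_eq_zero {u : Fin 2 × Fin 20 → ZMod 2} (h1 : valForm.mulVec u = 0)
    (h2 : legForm.mulVec u = 0) :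
    genMatrix.transpose.mulVec (dualMatrix.mulVec u) = u := by
  have h := congrArg (fun A ↦ Matrix.mulVec A u) one_eq_genMatrix_mul_dualMatrix_add
  simp only [Matrix.add_mulVec, ← Matrix.mulVec_mulVec, h1, h2, Matrix.mulVec_zero, add_zero,
    Matrix.one_mulVec] at h
  exact h.symm

/-! ### The local conditions for the curve -/

/-- The prime at a given position of `multPos`. -/
abbrev multPrime (l : Fin 16) : ℕ := (badGen (multPos l)).natAbs

lemma multPos_ne_zero (l : Fin 16) : multPos l ≠ 0 := by
  revert l; decide

lemma prime_multPrime (l : Fin 16) : (multPrime l).Prime := prime_badGen (multPos_ne_zero l)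

lemma multPrime_not_dvd : ∀ l : Fin 16,
    ¬ (multPrime l : ℤ) ∣ rootE (multIdx l + 1) - rootE (multIdx l) ∧
    ¬ (multPrime l : ℤ) ∣ rootE (multIdx l + 2) - rootE (multIdx l) ∧
    (multPrime l : ℤ) ∣ rootE (multIdx l + 1) - rootE (multIdx l + 2) := by
  decide +kernel

/-- Nonsplit reduction occurs only at primes which divide the difference of the roots once. -/
lemma legendreBit_eq_zero_or_not_sq_dvd : ∀ l : Fin 16, l ≠ 0 →
    legendreBit (multPrime l) (rootE (multIdx l + 1) - rootE (multIdx l)) = 0 ∨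
    ¬ (multPrime l : ℤ) ^ 2 ∣ rootE (multIdx l + 1) - rootE (multIdx l + 2) := by
  decide +kernel

lemma not_dvd_rootE_sub_of_not_bad {q : ℕ} (hq : q.Prime) (hbad : ∀ k, q ≠ (badGen k).natAbs)
    {i j : Fin 3} (hij : i ≠ j) : ¬ (q : ℤ) ∣ rootE i - rootE j := by
  -- The exponent 14 is the largest one in the factorizations of the differences.
  have key : ∀ i j : Fin 3, i ≠ j → rootE i - rootE j ∣ ∏ k, badGen k ^ 14 := by decide +kernel
  intro h
  have hp : Prime (q : ℤ) := Nat.prime_iff_prime_int.1 hq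
  obtain ⟨k, -, hk⟩ := hp.exists_mem_finset_dvd (h.trans (key i j hij))
  have h1 := hp.dvd_of_dvd_pow hk
  rw [Int.natCast_dvd] at h1
  by_cases hk0 : k = 0
  · subst hk0
    exact hq.one_lt.ne' (Nat.dvd_one.1 h1)
  · exact hbad k ((Nat.prime_dvd_prime_iff_eq hq (prime_badGen hk0)).1 h1)

/-- The local conditions hold for every rational point outside the 2-torsion. -/
lemma localForms_descentClass {x y : ℚ}
    (h : (splitCurve (fun i ↦ (rootE i : ℚ))).toAffine.Nonsingular x y) (hy : y ≠ 0) :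
    valForm.mulVec (descentClass (.some x y h)) = 0 ∧
      legForm.mulVec (descentClass (.some x y h)) = 0 := by
  have heq : y ^ 2 = (x - rootE 0) * (x - rootE 1) * (x - rootE 2) :=
    (splitCurve.equation_iff 0).1 h.1
  obtain ⟨-, -, -, -, -, hx, -⟩ := exists_integral_differences rootE heq hy
  have hgood (i : Fin 3) (q : ℕ) (hq : q.Prime) (hbad : ∀ k, q ≠ (badGen k).natAbs) :
      valParity q (x - rootE i) = 0 := by
    have := Fact.mk hq
    exact valParity_sub_eq_zero rootE i heq hy
      (not_dvd_rootE_sub_of_not_bad hq hbad (by fin_cases i <;> decide))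
      (not_dvd_rootE_sub_of_not_bad hq hbad (by fin_cases i <;> decide))
  have hu (c : Fin 2) (k : Fin 20) : descentClass (.some x y h) (c, k) =
      badClass (x - rootE c.castSucc) k := by
    change badClass (splitCurve.delta _ _ _) _ = _
    rw [splitCurve.delta_some, if_neg (sub_ne_zero.1 (hx _))]
  have hsum : badClass (x - rootE 0) + badClass (x - rootE 1) = badClass (x - rootE 2) := by
    have h1 := badClass_eq_zero_of_isSquare (pow_ne_zero 2 hy) ⟨y, sq y⟩
    rw [heq, badClass_mul (mul_ne_zero (hx 0) (hx 1)) (hx 2), badClass_mul (hx 0) (hx 1)] at h1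
    funext k
    exact CharTwo.add_eq_zero.1 (congrFun h1 k)
  -- Each component of the descent map is a combination of the first two.
  have hcomp (i : Fin 3) (k : Fin 20) :
      ∑ c, compCoeff i c * descentClass (.some x y h) (c, k) = badClass (x - rootE i) k := by
    rw [Fin.sum_univ_two, hu, hu]
    fin_cases i
    · simp [compCoeff]
    · simp [compCoeff]
    · simpa [compCoeff] using congrFun hsum k
  have hpos (i : Fin 3) (l : Fin 16) :
      badClass (x - rootE i) (multPos l) = valParity (multPrime l) (x - rootE i) := by
    rw [badClass, if_neg (multPos_ne_zero l)]
  generalize descentClass (.some x y h) = u at hcomp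
  constructor
  · funext l
    have := Fact.mk (prime_multPrime l)
    obtain ⟨h1, h2, -⟩ := multPrime_not_dvd l
    have h3 := valParity_sub_eq_zero rootE (multIdx l) heq hy h1 h2
    rw [← hpos, ← hcomp] at h3
    rw [Pi.zero_apply, ← h3, Matrix.mulVec, dotProduct, Fintype.sum_prod_type]
    refine Finset.sum_congr rfl fun c _ ↦ ?_
    simp [valForm, ite_mul]
  · funext l
    rw [Pi.zero_apply, Matrix.mulVec, dotProduct]
    by_cases hl : l = 0
    · exact Finset.sum_eq_zero fun ck _ ↦ by rw [legForm, if_pos hl, zero_mul]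
    have := Fact.mk (prime_multPrime l)
    obtain ⟨h1, h2, h3⟩ := multPrime_not_dvd l
    have h4 := sum_legendreBit_mul_badClass rootE (multIdx l) heq hy h1 h2 h3
      (legendreBit_eq_zero_or_not_sq_dvd l hl) (hgood _)
    rw [← hpos, ← hcomp] at h4
    simp only [← hcomp] at h4
    rw [← CharTwo.add_eq_zero] at h4
    rw [← h4, Fintype.sum_prod_type_right]
    simp only [Finset.mul_sum]
    rw [Finset.sum_comm, Finset.sum_comm (s := (Finset.univ : Finset (Fin 20)))]
    rw [← Finset.sum_add_distrib]
    refine Finset.sum_congr rfl fun c _ ↦ ?_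
    simp only [legForm, if_neg hl, add_mul, ite_mul, zero_mul, Finset.sum_add_distrib,
      Finset.sum_ite_eq', Finset.mem_univ, if_true, mul_assoc]

/-- A point whose descent class vanishes is divisible by two. -/
lemma exists_add_self_of_descentClass_eq_zero {x y : ℚ}
    (h : (splitCurve (fun i ↦ (rootE i : ℚ))).toAffine.Nonsingular x y) (hy : y ≠ 0)
    (h0 : descentClass (.some x y h) = 0) : ∃ Q : PointE, Q + Q = .some x y h := by
  have heq : y ^ 2 = (x - rootE 0) * (x - rootE 1) * (x - rootE 2) :=
    (splitCurve.equation_iff 0).1 h.1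
  obtain ⟨-, -, -, -, -, hx, -⟩ := exists_integral_differences rootE heq hy
  have hu (c : Fin 2) : badClass (x - rootE c.castSucc) = 0 := by
    funext k
    have h1 := congrFun h0 (c, k)
    change badClass (splitCurve.delta _ _ _) _ = _ at h1
    rwa [splitCurve.delta_some, if_neg (sub_ne_zero.1 (hx _))] at h1
  have hsq (c : Fin 2) : IsSquare (x - rootE c.castSucc) := by
    refine isSquare_of_badClass_eq_zero (hx _) (fun q hq hbad ↦ ?_) (hu c)
    have := Fact.mk hq
    exact valParity_sub_eq_zero rootE _ heq hy
      (not_dvd_rootE_sub_of_not_bad hq hbad (by fin_cases c <;> decide))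
      (not_dvd_rootE_sub_of_not_bad hq hbad (by fin_cases c <;> decide))
  refine splitCurve.exists_add_self_eq rootE_injective h fun i ↦ ?_
  obtain ⟨r, hr⟩ : IsSquare (x - rootE 0) := hsq 0
  obtain ⟨s, hs⟩ : IsSquare (x - rootE 1) := hsq 1
  fin_cases i
  · exact ⟨r, hr⟩
  · exact ⟨s, hs⟩
  · have h0 := hx 0
    have h1 := hx 1
    have hr0 : r ≠ 0 := by rintro rfl; exact h0 (by rw [hr]; ring)
    have hs0 : s ≠ 0 := by rintro rfl; exact h1 (by rw [hs]; ring)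
    refine ⟨y / (r * s), ?_⟩
    change x - rootE 2 = _
    rw [hr, hs] at heq
    field_simp
    linear_combination -heq

/-! ### The descent classes of the known points -/

/-- The `x`-coordinates of the seven points, followed by those of two 2-torsion points. -/
def genX : Fin 9 → ℚ := Fin.append ptX fun j : Fin 2 ↦ (rootE j.castSucc : ℚ)

/-- The `y`-coordinates of the points with `x`-coordinates `genX`. -/
def genY : Fin 9 → ℚ := Fin.append ptY fun _ : Fin 2 ↦ 0

/-- Square roots of the quotients of the descent images of the known points by the squarefree
integers which represent them. -/
def genRoot : Fin 9 → Fin 2 → ℚ :=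
  ![![5082125, 4476], ![117495 / 113, 771364 / 113], ![537493 / 267, 80851480 / 267],
    ![55577 / 9, 2311108 / 9], ![373 / 29, 7460 / 29], ![112646 / 339, 98038201 / 339],
    ![8144455, 159644], ![22956285, 373], ![373, 4541170560]]

lemma genY_sq : ∀ i, genY i ^ 2 =
    (genX i - rootE 0) * (genX i - rootE (0 + 1)) * (genX i - rootE (0 + 2)) := by
  decide +kernel

/-- The seven points and two 2-torsion points. -/
def genPoint (i : Fin 9) : PointE :=
  .some (genX i) (genY i) (splitCurve.nonsingular_of_equation rootE_injective
    ((splitCurve.equation_iff 0).2 (genY_sq i)))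

lemma genDelta_eq : ∀ (i : Fin 9) (c : Fin 2),
    (if genX i = rootE c.castSucc then
      ((rootE c.castSucc : ℚ) - rootE (c.castSucc + 1)) *
        (rootE c.castSucc - rootE (c.castSucc + 2))
      else genX i - rootE c.castSucc) =
    classRep (fun k ↦ genMatrix i (c, k)) * (genRoot i c * genRoot i c) ∧ genRoot i c ≠ 0 := by
  decide +kernel

lemma descentClass_genPoint (i : Fin 9) : descentClass (genPoint i) = genMatrix i := by
  funext ⟨c, k⟩
  change badClass (splitCurve.delta _ _ (.some _ _ _)) k = _
  obtain ⟨h1, h2⟩ := genDelta_eq i c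
  rw [splitCurve.delta_some]
  simp only [h1]
  rw [badClass_mul (by exact_mod_cast classRep_ne_zero _) (mul_ne_zero h2 h2),
    badClass_mul_self h2, add_zero, badClass_classRep]

/-- The coordinates of the descent class of a point with respect to those of the known points. -/
def selmerCoord : PointE →+ (Fin 9 → ZMod 2) :=
  dualMatrix.mulVecLin.toAddMonoidHom.comp descentClass

lemma selmerCoord_genPoint (i : Fin 9) : selmerCoord (genPoint i) = Pi.single i 1 := by
  change dualMatrix.mulVec (descentClass (genPoint i)) = _
  rw [descentClass_genPoint]
  funext j
  have h := congrFun (congrFun dualMatrix_mul_genMatrix j) i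
  rw [Matrix.one_apply] at h
  rw [Pi.single_apply, ← h]
  rfl

lemma eq_zero_or_eq_of_Y_eq_zero {x : ℚ}
    (h : (splitCurve (fun i ↦ (rootE i : ℚ))).toAffine.Nonsingular x 0) :
    (.some x 0 h : PointE) = genPoint 7 ∨ (.some x 0 h : PointE) = genPoint 8 ∨
      (.some x 0 h : PointE) = genPoint 7 + genPoint 8 := by
  have heq : (0 : ℚ) ^ 2 = (x - rootE 0) * (x - rootE 1) * (x - rootE 2) :=
    (splitCurve.equation_iff 0).1 h.1
  have h7 : genX 7 = rootE 0 := rfl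
  have h8 : genX 8 = rootE 1 := rfl
  have k7 : genY 7 = 0 := rfl
  have k8 : genY 8 = 0 := rfl
  rw [zero_pow two_ne_zero, eq_comm, mul_eq_zero, mul_eq_zero, sub_eq_zero, sub_eq_zero,
    sub_eq_zero] at heq
  rcases heq with (rfl | rfl) | rfl
  · exact .inl rfl
  · exact .inr (.inl rfl)
  · right; right
    have hne : genX 7 ≠ genX 8 := by rw [h7, h8]; exact_mod_cast (by decide : rootE 0 ≠ rootE 1)
    have hs : (splitCurve (fun i ↦ (rootE i : ℚ))).toAffine.slope (genX 7) (genX 8) (genY 7)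
        (genY 8) = 0 := by
      rw [Affine.slope_of_X_ne hne, k7, k8, sub_self, zero_div]
    rw [genPoint, genPoint, Affine.Point.add_of_X_ne hne]
    simp only [Affine.Point.some.injEq, hs, Affine.addX, Affine.addY, Affine.negAddY, Affine.negY]
    rw [k7, h7, h8]
    constructor
    · simp only [splitCurve]
      ring
    · simp only [splitCurve]
      ring

lemma selmerCoord_ne_zero_of_Y_eq_zero {x : ℚ}
    (h : (splitCurve (fun i ↦ (rootE i : ℚ))).toAffine.Nonsingular x 0) :
    selmerCoord (.some x 0 h) ≠ 0 := by
  rcases eq_zero_or_eq_of_Y_eq_zero h with h1 | h1 | h1 <;> rw [h1]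
  · rw [selmerCoord_genPoint]
    decide
  · rw [selmerCoord_genPoint]
    decide
  · rw [map_add, selmerCoord_genPoint, selmerCoord_genPoint]
    decide

/-- Only the points of `2E(ℚ)` have trivial coordinates. -/
lemma exists_add_self_of_selmerCoord_eq_zero {P : PointE} (h0 : selmerCoord P = 0) :
    ∃ Q : PointE, Q + Q = P := by
  rcases P with _ | ⟨x, y, h⟩
  · exact ⟨0, zero_add (M := PointE) 0⟩
  · by_cases hy : y = 0
    · subst hy
      exact absurd h0 (selmerCoord_ne_zero_of_Y_eq_zero h)
    · have hd : dualMatrix.mulVec (descentClass (.some x y h)) = 0 := h0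
      obtain ⟨h1, h2⟩ := localForms_descentClass h hy
      refine exists_add_self_of_descentClass_eq_zero h hy
        ((eq_of_localForms_eq_zero h1 h2).symm.trans ?_)
      rw [hd, Matrix.mulVec_zero]

lemma selmerCoord_add_self (P : PointE) : selmerCoord (P + P) = 0 := by
  rw [map_add]
  funext k
  exact CharTwo.add_self_eq_zero (selmerCoord P k)

/-! ### Finite generation -/

instance isElliptic_splitCurve_rootE : (splitCurve (fun i ↦ (rootE i : ℚ))).IsElliptic := by
  rw [← curveE_eq]
  refine ⟨isUnit_iff_ne_zero.2 ?_⟩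
  norm_num [curveE, WeierstrassCurve.Δ, WeierstrassCurve.b₂, WeierstrassCurve.b₄,
    WeierstrassCurve.b₆, WeierstrassCurve.b₈]

lemma ker_selmerCoord : selmerCoord.ker = (nsmulAddMonoidHom (α := PointE) 2).range := by
  ext P
  rw [AddMonoidHom.mem_ker, AddMonoidHom.mem_range]
  constructor
  · intro h
    obtain ⟨Q, hQ⟩ := exists_add_self_of_selmerCoord_eq_zero h
    exact ⟨Q, by rw [← hQ]; exact two_nsmul Q⟩
  · rintro ⟨Q, rfl⟩
    rw [show nsmulAddMonoidHom 2 Q = Q + Q from two_nsmul Q]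
    exact selmerCoord_add_self Q

/-- The Mordell–Weil theorem for the curve. -/
instance fg_pointE : AddGroup.FG PointE := by
  apply Affine.Point.fg_of_finiteIndex
  rw [← ker_selmerCoord]
  infer_instance

/-! ### Multiplication by three on the 3-adic filtration -/

namespace WeierstrassCurve.Affine.Point

variable {F : Type*} [Field F] [DecidableEq F] {W : WeierstrassCurve F}

lemma X_add_self_mul [W.IsElliptic] {x y x₂ y₂ : F} {h : W.toAffine.Nonsingular x y}
    {h₂ : W.toAffine.Nonsingular x₂ y₂}
    (hP : (.some x y h + .some x y h : W.toAffine.Point) = .some x₂ y₂ h₂) :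
    x₂ * (4 * x ^ 3 + W.b₂ * x ^ 2 + 2 * W.b₄ * x + W.b₆) =
      x ^ 4 - W.b₄ * x ^ 2 - 2 * W.b₆ * x - W.b₈ := by
  obtain ⟨c, -, hc⟩ := addSubMap_sym2x_self (.some x y h : W.toAffine.Point)
  rw [hP] at hc
  have h0 := congrFun hc 0
  have h1 := congrFun hc 1
  simp [addSubMap] at h0 h1
  linear_combination x₂ * h1 - h0

lemma eq_zero_of_add_self_eq_zero [W.IsElliptic] {x y : F} {h : W.toAffine.Nonsingular x y}
    (hP : (.some x y h + .some x y h : W.toAffine.Point) = 0) :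
    4 * x ^ 3 + W.b₂ * x ^ 2 + 2 * W.b₄ * x + W.b₆ = 0 := by
  obtain ⟨c, -, hc⟩ := addSubMap_sym2x_self (.some x y h : W.toAffine.Point)
  rw [hP] at hc
  have h1 := congrFun hc 1
  simp [addSubMap] at h1
  linear_combination h1

lemma X_add_mul_X_sub [W.IsElliptic] {x₁ y₁ x₂ y₂ x₃ y₃ x₄ y₄ : F}
    {h₁ : W.toAffine.Nonsingular x₁ y₁} {h₂ : W.toAffine.Nonsingular x₂ y₂}
    {h₃ : W.toAffine.Nonsingular x₃ y₃} {h₄ : W.toAffine.Nonsingular x₄ y₄}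
    (hadd : (.some x₁ y₁ h₁ + .some x₂ y₂ h₂ : W.toAffine.Point) = .some x₃ y₃ h₃)
    (hsub : (.some x₁ y₁ h₁ - .some x₂ y₂ h₂ : W.toAffine.Point) = .some x₄ y₄ h₄) :
    x₃ * x₄ * (x₁ - x₂) ^ 2 =
      (x₁ * x₂) ^ 2 - W.b₄ * (x₁ * x₂) - W.b₆ * (x₁ + x₂) - W.b₈ := by
  obtain ⟨c, -, hc⟩ := addSubMap_sym2x (.some x₁ y₁ h₁ : W.toAffine.Point) (.some x₂ y₂ h₂)
  rw [hadd, hsub] at hc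
  have h0 := congrFun hc 0
  have h2 := congrFun hc 2
  simp [addSubMap] at h0 h2
  linear_combination x₃ * x₄ * h2 - h0

/-- The abscissa of a point of order three is a root of the third division polynomial. -/
lemma eq_zero_of_three_nsmul_eq_zero [W.IsElliptic] {x y : F} {h : W.toAffine.Nonsingular x y}
    (hP : 3 • (.some x y h : W.toAffine.Point) = 0) :
    3 * x ^ 4 + W.b₂ * x ^ 3 + 3 * W.b₄ * x ^ 2 + 3 * W.b₆ * x + W.b₈ = 0 := by
  have h2 : (.some x y h + .some x y h : W.toAffine.Point) = -.some x y h := by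
    rw [succ_nsmul, two_nsmul] at hP
    exact eq_neg_of_add_eq_zero_left hP
  rw [neg_some] at h2
  linear_combination X_add_self_mul h2

/-- The 3-adic absolute value of the abscissa. -/
def xNorm (W : WeierstrassCurve ℚ) : W.toAffine.Point → ℚ
  | 0 => 0
  | .some x _ _ => padicNorm 3 x

/-- If the invariants `bᵢ` are divisible by three, then multiplication by three multiplies by at
least nine the 3-adic absolute value of the abscissa of a point with nonsingular reduction: this
subgroup is filtered by the formal group, the reduction is additive, and `3` is the characteristic
of the residue field. -/
lemma nine_mul_xNorm_le {W : WeierstrassCurve ℚ} [W.IsElliptic] (hb₂ : padicNorm 3 W.b₂ ≤ 1 / 3)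
    (hb₄ : padicNorm 3 W.b₄ ≤ 1 / 3) (hb₆ : padicNorm 3 W.b₆ ≤ 1 / 3)
    (hb₈ : padicNorm 3 W.b₈ ≤ 1 / 3) {P : W.toAffine.Point} (hP : 1 ≤ xNorm W P)
    (h3 : 3 • P ≠ 0) : 9 * xNorm W P ≤ xNorm W (3 • P) := by
  have : Fact (Nat.Prime 3) := ⟨Nat.prime_three⟩
  rcases P with _ | ⟨x, y, h⟩
  · exact absurd (nsmul_zero 3) h3
  change 1 ≤ padicNorm 3 x at hP
  change 9 * padicNorm 3 x ≤ _
  have hn3 : padicNorm 3 3 = 1 / 3 := by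
    have := padicNorm.padicNorm_p_of_prime (p := 3)
    norm_num at this ⊢
    exact this
  have hn2 : padicNorm 3 2 ≤ 1 := by simpa using padicNorm.of_nat (p := 3) 2
  have hn4 : padicNorm 3 4 = 1 := by
    simpa using (padicNorm.nat_eq_one_iff (p := 3) 4).2 (by norm_num)
  have hn0 (z : ℚ) : 0 ≤ padicNorm 3 z := padicNorm.nonneg z
  have hadd {a b r : ℚ} (ha : padicNorm 3 a ≤ r) (hb : padicNorm 3 b ≤ r) :
      padicNorm 3 (a + b) ≤ r := padicNorm.nonarchimedean.trans (max_le ha hb)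
  have hsub {a b r : ℚ} (ha : padicNorm 3 a ≤ r) (hb : padicNorm 3 b ≤ r) :
      padicNorm 3 (a - b) ≤ r := padicNorm.sub.trans (max_le ha hb)
  have hdom {a b : ℚ} (hab : padicNorm 3 b < padicNorm 3 a) :
      padicNorm 3 (a + b) = padicNorm 3 a := by
    rw [padicNorm.add_eq_max_of_ne hab.ne', max_eq_left hab.le]
  have hpow (z : ℚ) (n : ℕ) : padicNorm 3 (z ^ n) = padicNorm 3 z ^ n := by
    induction n with
    | zero => simp
    | succ n ih => rw [pow_succ, padicNorm.mul, ih, pow_succ]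
  set r := padicNorm 3 x with hr
  have hr0 : 0 < r := by linarith
  -- A term with a coefficient divisible by three is small.
  have hterm {a z : ℚ} {s : ℚ} (ha : padicNorm 3 a ≤ 1 / 3) (hz : padicNorm 3 z ≤ s) :
      padicNorm 3 (a * z) ≤ s / 3 := by
    rw [padicNorm.mul]
    calc _ ≤ 1 / 3 * s := mul_le_mul ha hz (hn0 _) (by norm_num)
      _ = s / 3 := by ring
  have hxpow {m n : ℕ} (hmn : m ≤ n) : padicNorm 3 (x ^ m) ≤ r ^ n := by
    rw [hpow]
    exact pow_le_pow_right₀ hP hmn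
  have hx1 {n : ℕ} (hn : 1 ≤ n) : padicNorm 3 x ≤ r ^ n := by simpa using hxpow hn
  have htwo {a s : ℚ} (ha : padicNorm 3 a ≤ s) : padicNorm 3 (2 * a) ≤ s := by
    rw [padicNorm.mul]
    exact (mul_le_of_le_one_left (hn0 _) hn2).trans ha
  have hone {n : ℕ} : padicNorm 3 1 ≤ r ^ n := by simpa using hxpow (Nat.zero_le n)
  have hlt {n : ℕ} : r ^ n / 3 < r ^ n := by
    have : 0 < r ^ n := pow_pos hr0 n
    linarith
  have hΨ : padicNorm 3 (4 * x ^ 3 + W.b₂ * x ^ 2 + 2 * W.b₄ * x + W.b₆) = r ^ 3 := by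
    have h4 : padicNorm 3 (4 * x ^ 3) = r ^ 3 := by rw [padicNorm.mul, hn4, one_mul, hpow]
    rw [add_assoc, add_assoc, hdom, h4]
    rw [h4]
    refine (hadd (hterm hb₂ (hxpow (by norm_num))) (hadd ?_ ?_)).trans_lt hlt
    · exact hterm (htwo hb₄) (hx1 (by norm_num))
    · simpa using hterm hb₆ (hone (n := 3))
  have hψ : padicNorm 3 (3 * x ^ 4 + W.b₂ * x ^ 3 + 3 * W.b₄ * x ^ 2 + 3 * W.b₆ * x + W.b₈) ≤
      r ^ 4 / 3 := by
    have hle {a : ℚ} (ha : padicNorm 3 a ≤ 1 / 3) : padicNorm 3 (3 * a) ≤ 1 / 3 := by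
      rw [padicNorm.mul, hn3]
      linarith
    refine hadd (hadd (hadd (hadd ?_ ?_) ?_) ?_) ?_
    · exact hterm hn3.le (hxpow le_rfl)
    · exact hterm hb₂ (hxpow (by norm_num))
    · exact hterm (hle hb₄) (hxpow (by norm_num))
    · exact hterm (hle hb₆) (hx1 (by norm_num))
    · simpa using hterm hb₈ (hone (n := 4))
  rcases h2P : (.some x y h + .some x y h : W.toAffine.Point) with _ | ⟨x₂, y₂, h₂⟩
  · rw [eq_zero_of_add_self_eq_zero h2P, padicNorm.zero] at hΨ
    exact absurd hΨ (pow_pos hr0 3).ne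
  have hx₂ := X_add_self_mul h2P
  have hdiff : padicNorm 3 (x - x₂) ≤ r / 3 := by
    have h1 : (x - x₂) * (4 * x ^ 3 + W.b₂ * x ^ 2 + 2 * W.b₄ * x + W.b₆) =
        3 * x ^ 4 + W.b₂ * x ^ 3 + 3 * W.b₄ * x ^ 2 + 3 * W.b₆ * x + W.b₈ := by
      linear_combination -hx₂
    rw [← h1, padicNorm.mul, hΨ] at hψ
    have h2 : 0 < r ^ 3 := pow_pos hr0 3
    refine le_of_mul_le_mul_right (hψ.trans_eq ?_) h2
    ring
  have hrx₂ : padicNorm 3 x₂ = r := by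
    have h1 : x₂ = x + -(x - x₂) := by ring
    rw [h1, hdom]
    rw [padicNorm.neg]
    exact hdiff.trans_lt (by linarith)
  have h3P : 3 • (.some x y h : W.toAffine.Point) = .some x₂ y₂ h₂ + .some x y h := by
    rw [succ_nsmul, two_nsmul, h2P]
  have hP' : (.some x₂ y₂ h₂ - .some x y h : W.toAffine.Point) = .some x y h := by
    rw [← h2P, add_sub_cancel_right]
  rw [h3P] at h3 ⊢
  rcases h3P' : (.some x₂ y₂ h₂ + .some x y h : W.toAffine.Point) with _ | ⟨x₃, y₃, h₃⟩
  · exact absurd h3P' h3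
  rw [h3P']
  change 9 * r ≤ padicNorm 3 x₃
  have hx₃ := congrArg (padicNorm 3) (X_add_mul_X_sub h3P' hP')
  have hN : padicNorm 3 ((x₂ * x) ^ 2 - W.b₄ * (x₂ * x) - W.b₆ * (x₂ + x) - W.b₈) = r ^ 4 := by
    have h4 : padicNorm 3 ((x₂ * x) ^ 2) = r ^ 4 := by
      rw [hpow, padicNorm.mul, hrx₂]
      ring
    have h5 : (x₂ * x) ^ 2 - W.b₄ * (x₂ * x) - W.b₆ * (x₂ + x) - W.b₈ =
        (x₂ * x) ^ 2 + -(W.b₄ * (x₂ * x) + W.b₆ * (x₂ + x) + W.b₈) := by ring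
    rw [h5, hdom, h4]
    rw [h4, padicNorm.neg]
    refine (hadd (hadd (hterm hb₄ ?_) (hterm hb₆ ?_)) ?_).trans_lt hlt
    · rw [padicNorm.mul, hrx₂, ← sq]
      exact pow_le_pow_right₀ hP (by norm_num)
    · exact hadd (by rw [hrx₂]; exact hx1 (by norm_num)) (hx1 (by norm_num))
    · simpa using hterm hb₈ (hone (n := 4))
  rw [hN, padicNorm.mul, padicNorm.mul, hpow] at hx₃
  have hd : padicNorm 3 (x₂ - x) ≤ r / 3 := by
    rw [← padicNorm.neg, neg_sub]
    exact hdiff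
  have hd2 : padicNorm 3 (x₂ - x) ^ 2 ≤ (r / 3) ^ 2 := pow_le_pow_left₀ (hn0 _) hd 2
  have h6 : r ^ 4 ≤ padicNorm 3 x₃ * r * (r / 3) ^ 2 := by
    rw [← hx₃]
    exact mul_le_mul_of_nonneg_left hd2 (mul_nonneg (hn0 _) hr0.le)
  refine le_of_mul_le_mul_right ?_ (pow_pos hr0 3)
  linarith

end WeierstrassCurve.Affine.Point

/-! ### The torsion subgroup -/

/-- The invariants `b₂`, `b₄`, `b₆`, `b₈` of the curve. -/
def invB : Fin 4 → ℤ :=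
  ![4 * 19125010376436745905, 2 * 52038165131253677052054066913723699200,
    4 * 521987941186440643611574160434960523120404754595840000,
    4 * 19125010376436745905 * 521987941186440643611574160434960523120404754595840000
      - 52038165131253677052054066913723699200 ^ 2]

lemma b_splitCurve_rootE :
    (splitCurve (fun i ↦ (rootE i : ℚ))).b₂ = invB 0 ∧
    (splitCurve (fun i ↦ (rootE i : ℚ))).b₄ = invB 1 ∧
    (splitCurve (fun i ↦ (rootE i : ℚ))).b₆ = invB 2 ∧
    (splitCurve (fun i ↦ (rootE i : ℚ))).b₈ = invB 3 := by
  rw [← curveE_eq]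
  refine ⟨?_, ?_, ?_, ?_⟩ <;> decide +kernel

lemma padicNorm_invB_le (i : Fin 4) : padicNorm 3 (invB i) ≤ 1 / 3 := by
  have : Fact (Nat.Prime 3) := ⟨Nat.prime_three⟩
  have h : ∀ i : Fin 4, ((3 ^ 1 : ℕ) : ℤ) ∣ invB i := by decide
  have := padicNorm.dvd_iff_norm_le.1 (h i)
  norm_num at this ⊢
  exact this

/-- The third division polynomial has no projective root modulo 47. -/
lemma three_nsmul_ne_zero {P : PointE} (hP : P ≠ 0) : 3 • P ≠ 0 := by
  rcases P with _ | ⟨x, y, h⟩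
  · exact absurd rfl hP
  intro h3
  have h0 := Affine.Point.eq_zero_of_three_nsmul_eq_zero h3
  obtain ⟨e2, e4, e6, e8⟩ := b_splitCurve_rootE
  rw [e2, e4, e6, e8] at h0
  have hd : (x.den : ℚ) ≠ 0 := by exact_mod_cast x.den_nz
  have h1 : 3 * x.num ^ 4 + invB 0 * x.num ^ 3 * x.den + 3 * invB 1 * x.num ^ 2 * x.den ^ 2 +
      3 * invB 2 * x.num * x.den ^ 3 + invB 3 * x.den ^ 4 = 0 := by
    have hx : (x.num : ℚ) = x * x.den := (Rat.mul_den_eq_num x).symm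
    have : (3 * (x.num : ℚ) ^ 4 + invB 0 * x.num ^ 3 * x.den + 3 * invB 1 * x.num ^ 2 * x.den ^ 2 +
      3 * invB 2 * x.num * x.den ^ 3 + invB 3 * x.den ^ 4 : ℚ) = 0 := by
      rw [hx]
      linear_combination (x.den : ℚ) ^ 4 * h0
    exact_mod_cast this
  have key : ∀ n d : ZMod 47, 3 * n ^ 4 + (invB 0 : ℤ) * n ^ 3 * d + 3 * (invB 1 : ℤ) * n ^ 2 * d ^ 2
      + 3 * (invB 2 : ℤ) * n * d ^ 3 + (invB 3 : ℤ) * d ^ 4 = 0 → n = 0 ∧ d = 0 := by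
    decide +kernel
  have h2 := congrArg (Int.cast : ℤ → ZMod 47) h1
  simp only [Int.cast_add, Int.cast_mul, Int.cast_pow, Int.cast_ofNat, Int.cast_zero] at h2
  obtain ⟨hn, hd⟩ := key _ _ h2
  rw [ZMod.intCast_zmod_eq_zero_iff_dvd] at hn
  have hd' : 47 ∣ x.den := by
    rw [Int.cast_natCast] at hd
    exact (ZMod.natCast_eq_zero_iff _ _).1 hd
  have hn' : 47 ∣ x.num.natAbs := Int.natCast_dvd.1 hn
  have := Nat.dvd_gcd hn' hd'
  rw [x.reduced] at this
  norm_num at this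

/-- The points of `2E(ℚ)` outside the 2-torsion have nonsingular reduction at three. -/
lemma one_le_padicNorm_of_add_self {Q : PointE} {x y : ℚ}
    {h : (splitCurve (fun i ↦ (rootE i : ℚ))).toAffine.Nonsingular x y}
    (hQ : Q + Q = .some x y h) (hy : y ≠ 0) : 1 ≤ padicNorm 3 x := by
  have : Fact (Nat.Prime 3) := ⟨Nat.prime_three⟩
  have heq : y ^ 2 = (x - rootE 0) * (x - rootE 1) * (x - rootE 2) :=
    (splitCurve.equation_iff 0).1 h.1
  have hx (i : Fin 3) : x - rootE i ≠ 0 := by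
    intro h0
    apply hy
    rw [← sq_eq_zero_iff, heq]
    fin_cases i
    · exact mul_eq_zero_of_left (mul_eq_zero_of_left h0 _) _
    · exact mul_eq_zero_of_left (mul_eq_zero_of_right _ h0) _
    · exact mul_eq_zero_of_right _ h0
  have hsq (i : Fin 3) : ∃ r : ℚ, x - rootE i = r ^ 2 := by
    have h1 := splitCurve.isSquare_delta_add rootE_injective i Q Q
    rw [hQ, splitCurve.delta_some, if_neg (sub_ne_zero.1 (hx i))] at h1
    obtain ⟨s, hs⟩ := h1
    have h2 := splitCurve.delta_ne_zero rootE_injective i Q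
    refine ⟨s / splitCurve.delta (fun i ↦ (rootE i : ℚ)) i Q, ?_⟩
    field_simp
    linear_combination hs
  by_contra! hlt
  -- The differences of `x` with two roots would both be divisible by nine.
  have hsmall (i : Fin 3) (hi : (3 : ℤ) ∣ rootE i) : padicNorm 3 (x - rootE i) ≤ 1 / 9 := by
    have h1 : padicNorm 3 (x - rootE i) < 1 := by
      refine padicNorm.sub.trans_lt (max_lt hlt ?_)
      exact (padicNorm.int_lt_one_iff (p := 3) _).2 hi
    obtain ⟨r, hr⟩ := hsq i
    have hr0 : r ≠ 0 := by
      rintro rfl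
      exact hx i (by rw [hr]; ring)
    rw [hr, sq, padicNorm.mul, padicNorm.eq_zpow_of_nonzero hr0] at h1 ⊢
    rw [← zpow_add₀ (by norm_num)] at h1 ⊢
    have h2 : -padicValRat 3 r + -padicValRat 3 r < 0 := by
      by_contra! h3
      exact absurd h1 (not_lt.2 (one_le_zpow₀ (by norm_num) h3))
    have h3 : -padicValRat 3 r + -padicValRat 3 r ≤ -2 := by omega
    refine (zpow_le_zpow_right₀ (by norm_num) h3).trans (by norm_num)
  have h1 : padicNorm 3 ((rootE 0 - rootE 1 : ℤ) : ℚ) ≤ (3 : ℕ) ^ (-(2 : ℕ) : ℤ) := by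
    have h2 : ((rootE 0 - rootE 1 : ℤ) : ℚ) = (x - rootE 1) - (x - rootE 0) := by
      push_cast
      ring
    rw [h2]
    refine padicNorm.sub.trans ((max_le (hsmall 1 (by decide)) (hsmall 0 (by decide))).trans ?_)
    norm_num
  rw [← padicNorm.dvd_iff_norm_le] at h1
  revert h1
  decide

/-- There are no points of odd order. -/
lemma eq_zero_of_odd_nsmul_eq_zero {P : PointE} {n : ℕ} (hn : Odd n) (h : n • P = 0) : P = 0 := by
  by_contra hP
  set m := addOrderOf P with hm
  have hmn : m ∣ n := addOrderOf_dvd_of_nsmul_eq_zero h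
  have hmodd : Odd m := hn.of_dvd_nat hmn
  have hmP : m • P = 0 := addOrderOf_nsmul_eq_zero P
  have hm0 : 0 < m := hmodd.pos
  by_cases h3 : 3 ∣ m
  · obtain ⟨k, hk⟩ := h3
    refine three_nsmul_ne_zero (P := k • P) (fun hkP ↦ ?_) (by rw [← mul_nsmul', ← hk, hmP])
    have := Nat.le_of_dvd (by omega) (addOrderOf_dvd_of_nsmul_eq_zero hkP)
    omega
  have hcop : Nat.Coprime 3 m := (Nat.Prime.coprime_iff_not_dvd Nat.prime_three).2 h3
  have hdvd {k : ℕ} (hk : (3 ^ k) • P = 0) : False := by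
    have h1 : m ∣ 3 ^ k := addOrderOf_dvd_of_nsmul_eq_zero hk
    have h2 : m = 1 := Nat.Coprime.eq_one_of_dvd (hcop.pow_left k).symm h1
    rw [h2, one_nsmul] at hmP
    exact hP hmP
  obtain ⟨e2, e4, e6, e8⟩ := b_splitCurve_rootE
  have hstep {Q : PointE} (h1 : 1 ≤ Affine.Point.xNorm _ Q) (hQ : 3 • Q ≠ 0) :
      9 * Affine.Point.xNorm _ Q ≤ Affine.Point.xNorm _ (3 • Q) :=
    Affine.Point.nine_mul_xNorm_le (by rw [e2]; exact padicNorm_invB_le 0)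
      (by rw [e4]; exact padicNorm_invB_le 1) (by rw [e6]; exact padicNorm_invB_le 2)
      (by rw [e8]; exact padicNorm_invB_le 3) h1 hQ
  have hP1 : 1 ≤ Affine.Point.xNorm _ P := by
    obtain ⟨k, hk⟩ := hmodd
    have hQ : (k + 1) • P + (k + 1) • P = P := by
      rw [← add_nsmul, show k + 1 + (k + 1) = m + 1 by omega, succ_nsmul, hmP, zero_add]
    rcases hP' : P with _ | ⟨x, y, hxy⟩
    · exact absurd hP' hP
    rw [hP'] at hQ
    refine one_le_padicNorm_of_add_self hQ fun hy ↦ ?_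
    subst hy
    have h2 : 2 • P = 0 := by
      rw [two_nsmul, hP']
      exact Affine.Point.add_self_of_Y_eq (by simp [Affine.negY, splitCurve])
    have h1 : m ∣ 2 := addOrderOf_dvd_of_nsmul_eq_zero h2
    have h3 : m = 1 := by
      have := Nat.le_of_dvd two_pos h1
      omega
    rw [h3, one_nsmul] at hmP
    exact hP hmP
  have hpow (k : ℕ) : 9 ^ k * Affine.Point.xNorm _ P ≤ Affine.Point.xNorm _ ((3 ^ k) • P) := by
    induction k with
    | zero => simp
    | succ k ih =>
      have h1 : (1 : ℚ) ≤ 9 ^ k * Affine.Point.xNorm _ P :=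
        one_le_mul_of_one_le_of_one_le (one_le_pow₀ (by norm_num)) hP1
      have h2 : 3 ^ (k + 1) • P = 3 • 3 ^ k • P := by rw [pow_succ, mul_nsmul]
      rw [h2, pow_succ]
      refine le_trans ?_ (hstep (h1.trans ih) (by rw [← h2]; exact fun h0 ↦ hdvd h0))
      linarith
  -- The sequence of the multiples by powers of three is periodic.
  have hper : (3 ^ m.totient) • P = P := by
    have h1 : 3 ^ m.totient ≡ 1 [MOD addOrderOf P] := Nat.ModEq.pow_totient hcop
    simpa using nsmul_eq_nsmul_iff_modEq.2 h1
  have h1 := hpow m.totient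
  rw [hper] at h1
  have h2 : (1 : ℚ) < 9 ^ m.totient :=
    one_lt_pow₀ (by norm_num) (Nat.totient_pos.2 hm0).ne'
  nlinarith

lemma Y_eq_zero_of_two_nsmul_eq_zero {x y : ℚ}
    {h : (splitCurve (fun i ↦ (rootE i : ℚ))).toAffine.Nonsingular x y}
    (h2 : 2 • (.some x y h : PointE) = 0) : y = 0 := by
  by_contra hy
  rw [two_nsmul, Affine.Point.add_self_of_Y_ne] at h2
  · exact Affine.Point.some_ne_zero _ h2
  · simp only [Affine.negY, splitCurve]
    intro h1
    exact hy (by linarith)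

lemma eq_zero_or_eq_of_two_nsmul_eq_zero {P : PointE} (h : 2 • P = 0) :
    P = 0 ∨ P = genPoint 7 ∨ P = genPoint 8 ∨ P = genPoint 7 + genPoint 8 := by
  rcases P with _ | ⟨x, y, hxy⟩
  · exact .inl rfl
  obtain rfl := Y_eq_zero_of_two_nsmul_eq_zero h
  exact .inr (eq_zero_or_eq_of_Y_eq_zero hxy)

lemma two_nsmul_genPoint {i : Fin 9} (hi : 7 ≤ i) : 2 • genPoint i = 0 := by
  have hy : genY i = 0 := by
    revert i
    decide
  rw [two_nsmul, genPoint]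
  refine Affine.Point.add_self_of_Y_eq ?_
  rw [hy]
  simp [Affine.negY, splitCurve]

/-- There are no points of order four, since the 2-torsion points have nontrivial descent class. -/
lemma two_nsmul_eq_zero_of_four {P : PointE} (h : 2 • 2 • P = 0) : 2 • P = 0 := by
  have h1 : selmerCoord (2 • P) = 0 := by rw [two_nsmul]; exact selmerCoord_add_self P
  rcases h2 : 2 • P with _ | ⟨x, y, hxy⟩
  · rfl
  · rw [h2] at h h1
    obtain rfl := Y_eq_zero_of_two_nsmul_eq_zero h
    exact absurd h1 (selmerCoord_ne_zero_of_Y_eq_zero hxy)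

lemma two_nsmul_eq_zero_of_isOfFinAddOrder {P : PointE} (h : IsOfFinAddOrder P) : 2 • P = 0 := by
  obtain ⟨a, m, hm, hn⟩ := Nat.exists_eq_two_pow_mul_odd h.addOrderOf_pos.ne'
  have h0 : 2 ^ a • P = 0 := by
    refine eq_zero_of_odd_nsmul_eq_zero hm ?_
    rw [← mul_nsmul, ← hn, addOrderOf_nsmul_eq_zero]
  clear hn
  induction a with
  | zero =>
    rw [pow_zero, one_nsmul] at h0
    rw [h0, nsmul_zero]
  | succ a ih =>
    rcases a with _ | a
    · simpa using h0
    refine ih ?_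
    rw [pow_succ, mul_nsmul] at h0 ⊢
    refine two_nsmul_eq_zero_of_four ?_
    rw [pow_succ, mul_nsmul] at h0
    exact h0

/-! ### Rank and independence from a descent map -/

section Rank

variable {G : Type*} [AddCommGroup G]

lemma exists_addEquiv_torsion_prod [AddGroup.FG G] :
    ∃ r, Nonempty (G ≃+ AddCommGroup.torsion G × (Fin r → ℤ)) := by
  have : Module.Finite ℤ G := Module.Finite.iff_addGroup_fg.2 inferInstance
  obtain ⟨r, ⟨b⟩⟩ :=
    @Module.basisOfFiniteTypeTorsionFree' ℤ _ (G ⧸ Submodule.torsion ℤ G) _ _ _ _ _ _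
  obtain ⟨f, hf⟩ := Module.projective_lifting_property _ LinearMap.id
    (Submodule.torsion ℤ G).mkQ_surjective
  let e := (lequivProdOfRightSplitExact (Submodule.torsion ℤ G).injective_subtype
    (by rw [Submodule.range_subtype, Submodule.ker_mkQ]) hf).symm
  refine ⟨r, ⟨e.toAddEquiv.trans (AddEquiv.prodCongr (AddEquiv.addSubgroupCongr
    Submodule.torsion_int) (b.trans (Finsupp.linearEquivFunOnFinite ℤ ℤ (Fin r))).toAddEquiv)⟩⟩

/-- A homomorphism onto `(ℤ/2)ⁿ` whose kernel is `G_tors + 2G` determines the rank of a finitely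
generated abelian group. -/
theorem nonempty_addEquiv_torsion_prod [AddGroup.FG G] {n : ℕ} (c : G →+ (Fin n → ZMod 2))
    (hsurj : Function.Surjective c) (htors : ∀ P, IsOfFinAddOrder P → c P = 0)
    (hker : ∀ P, c P = 0 → ∃ Q, IsOfFinAddOrder (P - 2 • Q)) :
    Nonempty (G ≃+ AddCommGroup.torsion G × (Fin n → ℤ)) := by
  obtain ⟨r, ⟨φ⟩⟩ := exists_addEquiv_torsion_prod (G := G)
  suffices r = n by subst this; exact ⟨φ⟩
  let g : (Fin r → ℤ) →+ (Fin n → ZMod 2) :=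
    c.comp (φ.symm.toAddMonoidHom.comp (AddMonoidHom.inr _ _))
  have hg (v : Fin r → ℤ) : g v = c (φ.symm (0, v)) := rfl
  let f : (Fin r → ZMod 2) →ₗ[ZMod 2] (Fin n → ZMod 2) :=
    Fintype.linearCombination (ZMod 2) fun j ↦ g (Pi.single j 1)
  -- `f` is the reduction of `g` modulo two.
  have hfg (v : Fin r → ℤ) : f (fun j ↦ (v j : ZMod 2)) = g v := by
    conv_rhs => rw [← Finset.univ_sum_single v]
    rw [map_sum, Fintype.linearCombination_apply]
    refine Finset.sum_congr rfl fun j _ ↦ ?_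
    rw [show (Pi.single j (v j) : Fin r → ℤ) = v j • Pi.single j 1 by
      rw [← Pi.single_smul, smul_eq_mul, mul_one], map_zsmul, Int.cast_smul_eq_zsmul]
  have hlift (w : Fin r → ZMod 2) : ∃ v : Fin r → ℤ, (fun j ↦ (v j : ZMod 2)) = w :=
    ⟨fun j ↦ (w j).val, by funext j; simp⟩
  have htors' (t : AddCommGroup.torsion G) : IsOfFinAddOrder (φ.symm (t, 0)) := by
    have h1 : IsOfFinAddOrder (t : G) := t.2
    rw [isOfFinAddOrder_iff_nsmul_eq_zero] at h1 ⊢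
    obtain ⟨k, hk, h⟩ := h1
    refine ⟨k, hk, ?_⟩
    rw [← map_nsmul, Prod.smul_mk, nsmul_zero, show k • t = 0 from Subtype.ext h]
    exact map_zero φ.symm
  have hsplit (t : AddCommGroup.torsion G) (v : Fin r → ℤ) :
      φ.symm (t, v) = φ.symm (t, 0) + φ.symm (0, v) := by
    rw [← map_add, Prod.mk_add_mk, add_zero, zero_add]
  have hinj : Function.Injective f := by
    rw [injective_iff_map_eq_zero]
    intro w hw
    obtain ⟨v, rfl⟩ := hlift w
    rw [hfg, hg] at hw
    obtain ⟨Q, hQ⟩ := hker _ hw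
    have h1 : (φ (φ.symm (0, v) - 2 • Q)).2 = 0 := by
      rw [isOfFinAddOrder_iff_nsmul_eq_zero] at hQ
      obtain ⟨k, hk, h⟩ := hQ
      have h2 : k • (φ (φ.symm (0, v) - 2 • Q)).2 = 0 := by
        rw [← Prod.smul_snd, ← map_nsmul, h, map_zero, Prod.snd_zero]
      exact (smul_eq_zero.1 h2).resolve_left hk.ne'
    rw [map_sub, AddEquiv.apply_symm_apply, map_nsmul, Prod.snd_sub, sub_eq_zero] at h1
    funext j
    have h2 : v j = 2 * (φ Q).2 j := by simpa using congrFun h1 j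
    rw [h2]
    push_cast
    rw [show (2 : ZMod 2) = 0 from rfl, zero_mul]
    rfl
  have hfsurj : Function.Surjective f := by
    intro u
    obtain ⟨P, rfl⟩ := hsurj u
    obtain ⟨⟨t, v⟩, rfl⟩ := φ.symm.surjective P
    refine ⟨fun j ↦ (v j : ZMod 2), ?_⟩
    rw [hfg, hg, hsplit t v, map_add, htors _ (htors' t), zero_add]
  simpa using (LinearEquiv.ofBijective f ⟨hinj, hfsurj⟩).finrank_eq

/-- Elements with independent images modulo two are independent: by infinite descent, the
coefficients of a relation would be divisible by all powers of two. -/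
theorem linearIndependent_of_map_eq_single {n : ℕ} (c : G →+ (Fin n → ZMod 2))
    (htors : ∀ P, IsOfFinAddOrder P → c P = 0) {P : Fin n → G}
    (hP : ∀ i, c (P i) = Pi.single i 1) : LinearIndependent ℤ P := by
  have key (k : ℕ) : ∀ a : Fin n → ℤ, IsOfFinAddOrder (∑ i, a i • P i) →
      ∀ i, (2 : ℤ) ^ k ∣ a i := by
    induction k with
    | zero => intro a _ i; simp
    | succ k ih =>
      intro a ha
      have h1 (i : Fin n) : (2 : ℤ) ∣ a i := by
        have h2 := congrFun (htors _ ha) i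
        simp only [map_sum, map_zsmul, hP, Finset.sum_apply, Pi.smul_apply, Pi.single_apply,
          smul_ite, smul_zero, Finset.sum_ite_eq, Finset.mem_univ, if_true, Pi.zero_apply,
          zsmul_one] at h2
        exact (ZMod.intCast_zmod_eq_zero_iff_dvd _ 2).1 h2
      choose b hb using h1
      have h3 : ∑ i, a i • P i = 2 • ∑ i, b i • P i := by
        rw [Finset.smul_sum]
        refine Finset.sum_congr rfl fun i _ ↦ ?_
        rw [hb i, mul_smul]
        exact ofNat_zsmul _ 2
      rw [h3] at ha
      have h4 := ih b (ha.of_nsmul two_ne_zero)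
      intro i
      rw [hb i, pow_succ']
      exact mul_dvd_mul_left 2 (h4 i)
  refine Fintype.linearIndependent_iff.2 fun a ha i ↦ ?_
  by_contra hne
  refine hne (Int.eq_zero_of_abs_lt_dvd (key (a i).natAbs a ?_ i) ?_)
  · rw [ha]
    exact IsOfFinAddOrder.zero
  · rw [Int.abs_eq_natAbs]
    exact_mod_cast Nat.lt_two_pow_self

end Rank

/-! ### The structure of the Mordell–Weil group -/

/-- The coordinates of the descent class of a point with respect to those of the seven points. -/
def pointCoord : PointE →+ (Fin 7 → ZMod 2) :=
  AddMonoidHom.mk' (fun P i ↦ selmerCoord P (Fin.castAdd 2 i)) fun P Q ↦ by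
    rw [map_add]
    rfl

/-- The coordinates of the descent class of a point with respect to those of the two 2-torsion
points. -/
def torsionCoord : PointE →+ ZMod 2 × ZMod 2 :=
  AddMonoidHom.mk' (fun P ↦ (selmerCoord P 7, selmerCoord P 8)) fun P Q ↦ by
    rw [map_add]
    rfl

lemma pointCoord_genPoint (i : Fin 7) :
    pointCoord (genPoint (Fin.castAdd 2 i)) = Pi.single i 1 := by
  funext j
  change selmerCoord _ _ = _
  rw [selmerCoord_genPoint]
  revert i j
  decide

lemma torsionCoord_genPoint_seven : torsionCoord (genPoint 7) = (1, 0) := by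
  change (selmerCoord _ _, selmerCoord _ _) = _
  rw [selmerCoord_genPoint]
  decide

lemma torsionCoord_genPoint_eight : torsionCoord (genPoint 8) = (0, 1) := by
  change (selmerCoord _ _, selmerCoord _ _) = _
  rw [selmerCoord_genPoint]
  decide

lemma isOfFinAddOrder_genPoint {i : Fin 9} (hi : 7 ≤ i) : IsOfFinAddOrder (genPoint i) :=
  isOfFinAddOrder_iff_nsmul_eq_zero.2 ⟨2, two_pos, two_nsmul_genPoint hi⟩

theorem nonempty_torsion_addEquiv :
    Nonempty (AddCommGroup.torsion PointE ≃+ ZMod 2 × ZMod 2) := by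
  refine ⟨AddEquiv.ofBijective (torsionCoord.comp (AddCommGroup.torsion PointE).subtype) ⟨?_, ?_⟩⟩
  · rw [injective_iff_map_eq_zero]
    rintro ⟨P, hP⟩ h0
    change torsionCoord P = 0 at h0
    refine Subtype.ext ?_
    change P = 0
    rcases eq_zero_or_eq_of_two_nsmul_eq_zero (two_nsmul_eq_zero_of_isOfFinAddOrder hP) with
      h1 | h1 | h1 | h1
    · exact h1
    all_goals
      exfalso
      rw [h1] at h0
    · rw [torsionCoord_genPoint_seven] at h0
      revert h0; decide
    · rw [torsionCoord_genPoint_eight] at h0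
      revert h0; decide
    · rw [map_add, torsionCoord_genPoint_seven, torsionCoord_genPoint_eight] at h0
      revert h0; decide
  · rintro ⟨a, b⟩
    refine ⟨⟨a.val • genPoint 7 + b.val • genPoint 8,
      ((isOfFinAddOrder_genPoint (by decide)).nsmul).add
        ((isOfFinAddOrder_genPoint (by decide)).nsmul)⟩, ?_⟩
    change torsionCoord (a.val • genPoint 7 + b.val • genPoint 8) = _
    rw [map_add, map_nsmul, map_nsmul, torsionCoord_genPoint_seven, torsionCoord_genPoint_eight]
    simp

lemma pointCoord_eq_zero_of_isOfFinAddOrder (P : PointE) (hP : IsOfFinAddOrder P) :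
    pointCoord P = 0 := by
  have h7 : pointCoord (genPoint 7) = 0 := by
    funext j
    change selmerCoord _ _ = _
    rw [selmerCoord_genPoint]
    revert j
    decide
  have h8 : pointCoord (genPoint 8) = 0 := by
    funext j
    change selmerCoord _ _ = _
    rw [selmerCoord_genPoint]
    revert j
    decide
  rcases eq_zero_or_eq_of_two_nsmul_eq_zero (two_nsmul_eq_zero_of_isOfFinAddOrder hP) with
    h1 | h1 | h1 | h1 <;> rw [h1]
  · exact map_zero _
  · exact h7
  · exact h8
  · rw [map_add, h7, h8, add_zero]

lemma exists_isOfFinAddOrder_sub_of_pointCoord_eq_zero (P : PointE) (hP : pointCoord P = 0) :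
    ∃ Q, IsOfFinAddOrder (P - 2 • Q) := by
  set T : PointE := (selmerCoord P 7).val • genPoint 7 + (selmerCoord P 8).val • genPoint 8 with hT
  have h0 : selmerCoord (P - T) = 0 := by
    have h4 (z : ZMod 2) (i : Fin 9) :
        z.val • (Pi.single i 1 : Fin 9 → ZMod 2) = Pi.single i z := by
      rw [← Pi.single_smul]
      simp
    rw [hT, map_sub, map_add, map_nsmul, map_nsmul, selmerCoord_genPoint, selmerCoord_genPoint,
      h4, h4]
    have h1 (j : Fin 7) : selmerCoord P (Fin.castAdd 2 j) = 0 := congrFun hP j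
    generalize selmerCoord P = u at h1
    funext k
    have h2 : ∀ j : Fin 7, (Fin.castAdd 2 j : Fin 9) ≠ 7 ∧ (Fin.castAdd 2 j : Fin 9) ≠ 8 := by
      decide
    have h3 : ∀ k : Fin 9, (∃ j : Fin 7, Fin.castAdd 2 j = k) ∨ k = 7 ∨ k = 8 := by decide
    obtain ⟨j, rfl⟩ | rfl | rfl := h3 k
    · simp [h1 j, (h2 j).1, (h2 j).2]
    · simp
    · simp
  obtain ⟨Q, hQ⟩ := exists_add_self_of_selmerCoord_eq_zero h0
  refine ⟨Q, ?_⟩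
  rw [two_nsmul, hQ, sub_sub_cancel]
  exact ((isOfFinAddOrder_genPoint (by decide)).nsmul).add
    ((isOfFinAddOrder_genPoint (by decide)).nsmul)

lemma pointCoord_surjective : Function.Surjective pointCoord := by
  intro u
  refine ⟨∑ i, (u i).val • genPoint (Fin.castAdd 2 i), ?_⟩
  rw [map_sum]
  conv_rhs => rw [← Finset.univ_sum_single u]
  refine Finset.sum_congr rfl fun i _ ↦ ?_
  rw [map_nsmul, pointCoord_genPoint, ← Pi.single_smul]
  simp

theorem theorem3 :
    -- the curve is the member `t = 2` of the family
    (famB 2 = 2176 / 373 ∧ famD 2 = 122265 / 101456 ∧ famE 2 = 192386145 / 101456) ∧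
    -- its product form and its Weierstrass form agree up to scaling of the coordinates
    (∀ x y : ℚ,
      y ^ 2 = (2176 / 373 * x + 1) * (192386145 / 101456 * x + 1) * (122265 / 101456 * x + 1) ↔
        curveE.toAffine.Equation
          (373 * 2176 * 192386145 * 122265 * x)
          (373 * 101456 * (373 * 2176 * 192386145 * 122265) * y)) ∧
    -- it is an elliptic curve over `ℚ`, with torsion `ℤ/2 × ℤ/2` and rank exactly `7`
    curveE.IsElliptic ∧
    Nonempty (AddCommGroup.torsion (RatPoints curveE) ≃+ ZMod 2 × ZMod 2) ∧
    HasRank curveE 7 ∧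
    -- the seven explicit points lie on it and are independent
    (∃ P : Fin 7 → RatPoints curveE,
      (∀ i, ∃ h : curveE.toAffine.Nonsingular (ptX i) (ptY i),
        P i = WeierstrassCurve.Affine.Point.some (ptX i) (ptY i) h) ∧
      LinearIndependent ℤ P) := by
  refine ⟨⟨by norm_num [famB], by norm_num [famD], by norm_num [famE]⟩, fun x y ↦ ?_, ?_⟩
  · rw [Affine.equation_iff]
    simp only [curveE]
    set K : ℚ := (373 * 101456 * (373 * 2176 * 192386145 * 122265)) ^ 2 with hK
    constructor
    · intro h
      linear_combination K * h
    · intro h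
      linear_combination 1 / K * h
  rw [curveE_eq]
  refine ⟨inferInstance, nonempty_torsion_addEquiv, ?_, fun i ↦ genPoint (Fin.castAdd 2 i), ?_, ?_⟩
  · exact nonempty_addEquiv_torsion_prod pointCoord pointCoord_surjective
      pointCoord_eq_zero_of_isOfFinAddOrder exists_isOfFinAddOrder_sub_of_pointCoord_eq_zero
  · intro i
    fin_cases i <;> exact ⟨_, rfl⟩
  · exact linearIndependent_of_map_eq_single pointCoord pointCoord_eq_zero_of_isOfFinAddOrder
      pointCoord_genPoint
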